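/- A diagram of an oriented knot on the closed oriented surface $S_g$ of genus $g$ means a knot diagram $K$ without virtual crossings on $S_g$ whose underlying surface is $S_g$: if $S'(K)$ is the oriented band surface of $K$ (discs at the crossings, joined by untwisted bands along the edges), then pasting discs to all boundary components of $S'(K)$ gives $S_g$. The boundary components of $S'(K)$ are called the pasted cycles of $K$. Diagrams are regarded up to virtual equivalence (detour moves), i.e. as Gauss diagrams (an oriented circle with signed chords directed from the overcrossing to the undercrossing); making a crossing virtual means deleting its chord. A diagram is called classical if it is virtually equivalent to a diagram without virtual crossings on the sphere. The parity group $G(K)$ is the abelian group generated by the crossings of $K$ with the relations $2a=0$ for every crossing $a$, and, for every pasted cycle, the relation that the sum of the crossings it touches (one summand for each corner which it turns around) is zero. Let $l(K)$ be the diagram obtained from $K$ by making virtual every crossing whose element of $G(K)$ is nonzero. **Theorem.** (1) Let $K$ and $K_1$ be two diagrams on $S_g$ as above (with the same $g$) which differ by one Reidemeister move. Then either $l(K)$ and $l(K_1)$ differ by the same Reidemeister move (of the same type, in the same direction and on the same crossings), or $l(K)$ and $l(K_1)$ are virtually equivalent (they coincide as Gauss diagrams, with corresponding crossings corresponding to each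 other). (2) For a diagram $K$ on $S_g$ as above, $l(K)$ is virtually equivalent to $K$ if and only if $K$ is classical. -/

import Mathlib

/-- Deleting letters from a cyclic word: the letters that satisfy `P` are kept, in their
cyclic order. -/
noncomputable def cyclicFilter {α : Type*} (P : α → Prop) : Cycle α → Cycle α :=
  open Classical in
  Quotient.map' (fun l : List α => l.filter (fun a => decide (P a))) (by
    intro l l' h
    obtain ⟨n, rfl⟩ := h
    show List.IsRotated _ _
    rw [List.rotate_eq_drop_append_take_mod, List.filter_append]
    conv_lhs => rw [← List.take_append_drop (n % l.length) l, List.filter_append]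
    exact List.isRotated_append)

/-- One end of a chord of a Gauss diagram: the name of the chord (a classical crossing), whether
it is the overcrossing end (the tail of the arrow) or the undercrossing end (the head of the
arrow), and the sign of the crossing. -/
@[ext]
structure ChordEnd (X : Type*) where
  crossing : X
  isOver : Bool
  sign : ℤˣ

/-- The other end of the same chord. -/
def ChordEnd.opposite {X : Type*} (p : ChordEnd X) : ChordEnd X :=
  ⟨p.crossing, !p.isOver, p.sign⟩

/-- Renaming of chords. -/
def ChordEnd.relabel {X Y : Type*} (f : X → Y) (p : ChordEnd X) : ChordEnd Y :=
  ⟨f p.crossing, p.isOver, p.sign⟩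

/-- A Gauss diagram of a knot, with chords named by elements of `X`: the cyclic word of chord ends
met along the oriented core circle. Every chord that occurs has exactly one overcrossing end and
one undercrossing end, and the two ends carry the same sign. The empty cyclic word is the Gauss
diagram of the circle without crossings.

A virtual knot diagram up to virtual equivalence (detour moves) is the same thing as its Gauss
diagram; making a classical crossing virtual is deleting its chord. -/
@[ext]
structure GaussDiagram (X : Type*) where
  core : Cycle (ChordEnd X)
  nodup_ends : (core.map fun p => (p.crossing, p.isOver)).Nodup
  opposite_mem : ∀ p ∈ core, p.opposite ∈ core

namespace GaussDiagram

variable {X Y : Type*}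

theorem nodup_core (K : GaussDiagram X) : K.core.Nodup := by
  have h := K.nodup_ends
  revert h
  refine Quotient.inductionOn' K.core (fun l h => ?_)
  exact List.Nodup.of_map _ h

/-- The chord ends of `K`, i.e. the passages of the knot through its classical crossings. -/
abbrev End (K : GaussDiagram X) : Type _ := {p : ChordEnd X // p ∈ K.core}

/-- The classical crossings (chords) of `K`. -/
abbrev Crossing (K : GaussDiagram X) : Type _ := {x : X // ∃ p ∈ K.core, p.crossing = x}

/-- The crossing that a chord end belongs to. -/
def End.toCrossing {K : GaussDiagram X} (p : K.End) : K.Crossing :=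
  ⟨p.1.crossing, p.1, p.2, rfl⟩

open Classical in
/-- The next chord end along the oriented core circle. -/
noncomputable def succ (K : GaussDiagram X) : Equiv.Perm K.End where
  toFun p := ⟨K.core.next K.nodup_core p.1 p.2, K.core.next_mem K.nodup_core p.1 p.2⟩
  invFun p := ⟨K.core.prev K.nodup_core p.1 p.2, K.core.prev_mem K.nodup_core p.1 p.2⟩
  left_inv p := Subtype.ext (K.core.prev_next K.nodup_core p.1 p.2)
  right_inv p := Subtype.ext (K.core.next_prev K.nodup_core p.1 p.2)

/-- The other passage through the same crossing. -/
def opp (K : GaussDiagram X) (p : K.End) : K.End := ⟨p.1.opposite, K.opposite_mem p.1 p.2⟩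

/-- The half-edges of the four-valent graph whose vertices are the classical crossings of `K`:
`(p, true)` is the half-edge by which the knot leaves the crossing after the passage `p`, and
`(p, false)` is the half-edge by which it arrives for the passage `p`. -/
abbrev HalfEdge (K : GaussDiagram X) : Type _ := K.End × Bool

theorem finite_core (K : GaussDiagram X) : {p : ChordEnd X | p ∈ K.core}.Finite := by
  generalize K.core = c
  refine Quotient.inductionOn' c (fun w => ?_)
  exact w.finite_toSet

instance (K : GaussDiagram X) : Finite K.End := K.finite_core.to_subtype

noncomputable instance (K : GaussDiagram X) : Fintype K.HalfEdge := Fintype.ofFinite _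

/-- The other half of the same edge: the edge that leaves the crossing after the passage `p`
arrives for the passage `succ p`. -/
noncomputable def otherHalf (K : GaussDiagram X) : Equiv.Perm K.HalfEdge where
  toFun d := if d.2 then (K.succ d.1, false) else (K.succ.symm d.1, true)
  invFun d := if d.2 then (K.succ d.1, false) else (K.succ.symm d.1, true)
  left_inv := by rintro ⟨p, _ | _⟩ <;> simp
  right_inv := by rintro ⟨p, _ | _⟩ <;> simp

/-- The counterclockwise rotation of the four half-edges at a crossing. With `o`, `u` the over- and
the under-passage, the counterclockwise order is
`o` out, `u` out, `o` in, `u` in at a positive crossing, and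
`o` out, `u` in, `o` in, `u` out at a negative one. -/
def rotation (K : GaussDiagram X) : Equiv.Perm K.HalfEdge where
  toFun d := (K.opp d.1, if (d.1.1.isOver = true ↔ d.1.1.sign = 1) then d.2 else !d.2)
  invFun d := (K.opp d.1, if (d.1.1.isOver = true ↔ d.1.1.sign = 1) then !d.2 else d.2)
  left_inv := by
    rintro ⟨⟨⟨x, o, s⟩, h⟩, b⟩
    by_cases hs : s = 1 <;> cases o <;> simp [opp, ChordEnd.opposite, hs]
  right_inv := by
    rintro ⟨⟨⟨x, o, s⟩, h⟩, b⟩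
    by_cases hs : s = 1 <;> cases o <;> simp [opp, ChordEnd.opposite, hs]

/-- One step along a boundary component of the band surface `S'(K)` (discs at the crossings, with
the above cyclic orders, joined by untwisted bands along the edges): go along the edge to its other
end, then turn to the neighbouring half-edge there. -/
noncomputable def boundaryStep (K : GaussDiagram X) : Equiv.Perm K.HalfEdge :=
  K.otherHalf.trans K.rotation

/-- The pasted (rotating) cycles of `K`: the boundary components of `S'(K)`, i.e. the orbits of
`boundaryStep`. The half-edges `d` of an orbit correspond to the corners which the boundary
component turns around, the corner of `d` being at the crossing of `d`. -/
abbrev PastedCycle (K : GaussDiagram X) : Type _ :=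
  Quotient (Equiv.Perm.SameCycle.setoid K.boundaryStep)

open Classical in
/-- The Euler characteristic of the closed oriented surface `S(K)`, obtained from `S'(K)` by pasting
a disc to every boundary component: crossings minus edges plus pasted cycles (there are as many
edges as chord ends). For the circle without crossings, `S'(K)` is an annulus and `S(K)` is a
sphere. -/
noncomputable def eulerChar (K : GaussDiagram X) : ℤ :=
  if K.core = Cycle.nil then 2
  else (Nat.card K.Crossing : ℤ) - (K.core.length : ℤ) + (Nat.card K.PastedCycle : ℤ)

/-- `K` is a diagram on the surface `S_g` of genus `g`: the (connected, oriented) underlying surface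
`S(K)` has genus `g`. -/
def HasGenus (K : GaussDiagram X) (g : ℕ) : Prop := K.eulerChar = 2 - 2 * (g : ℤ)

/-- Virtual equivalence of diagrams: they have the same Gauss diagram, up to the names of the
chords. (The renaming is automatically injective on the chords of `K`.) -/
def VirtuallyEquivalent (K : GaussDiagram X) (K' : GaussDiagram Y) : Prop :=
  ∃ f : X → Y, K.core.map (ChordEnd.relabel f) = K'.core

/-- `K` is virtually equivalent to a classical diagram, i.e. to a diagram without virtual crossings
on the sphere (`S_g` with `g = 0`). -/
def IsClassical (K : GaussDiagram X) : Prop :=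
  ∃ K' : GaussDiagram X, K'.HasGenus 0 ∧ VirtuallyEquivalent K K'

open Classical in
/-- The sum of the crossings touched by a pasted cycle (one summand for every corner). -/
noncomputable def cycleSum (K : GaussDiagram X) (C : K.PastedCycle) :
    FreeAbelianGroup K.Crossing :=
  ∑ d : K.HalfEdge with (Quotient.mk _ d : K.PastedCycle) = C, FreeAbelianGroup.of d.1.toCrossing

/-- The relations of the parity group: `2 a = 0` for every crossing `a`, and the sum of the
crossings along every pasted cycle is zero. -/
def parityRelations (K : GaussDiagram X) : Set (FreeAbelianGroup K.Crossing) :=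
  {r | ∃ a : K.Crossing, r = 2 • FreeAbelianGroup.of a} ∪ {r | ∃ C : K.PastedCycle, r = K.cycleSum C}

/-- The parity group `G(K)`: the abelian group generated by the crossings of `K` subject to
`parityRelations`. -/
abbrev ParityGroup (K : GaussDiagram X) : Type _ :=
  FreeAbelianGroup K.Crossing ⧸ AddSubgroup.closure K.parityRelations

/-- The element of the parity group that corresponds to a crossing. -/
def parity (K : GaussDiagram X) (a : K.Crossing) : K.ParityGroup :=
  QuotientAddGroup.mk (FreeAbelianGroup.of a)

/-- The crossing named `x` occurs in `K` and its element of `G(K)` is zero. -/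
def IsEven (K : GaussDiagram X) (x : X) : Prop :=
  ∃ h : ∃ p ∈ K.core, p.crossing = x, K.parity ⟨x, h⟩ = 0

/-- The diagram `l(K)`: all crossings whose element of `G(K)` is nonzero are made virtual, i.e.
their chords are deleted from the Gauss diagram. -/
noncomputable def l (K : GaussDiagram X) : GaussDiagram X where
  core := cyclicFilter (fun p => K.IsEven p.crossing) K.core
  nodup_ends := by
    have h := K.nodup_ends
    generalize (fun p : ChordEnd X => K.IsEven p.crossing) = P
    revert h
    refine Quotient.inductionOn' K.core (fun w h => ?_)
    exact List.Nodup.sublist (List.filter_sublist.map _) h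
  opposite_mem := by
    have h := K.opposite_mem
    have hP : ∀ p : ChordEnd X, K.IsEven p.crossing → K.IsEven p.opposite.crossing :=
      fun p hp => hp
    revert h
    refine Quotient.inductionOn' K.core (fun w h => ?_)
    intro p hp
    have hp' := List.mem_filter.1 hp
    refine List.mem_filter.2 ⟨h p hp'.1, ?_⟩
    simpa using hP p (by simpa using hp'.2)

end GaussDiagram

/-- Reidemeister moves, with the names of the crossings taking part. Crossings of the two diagrams
that correspond to each other under a move have the same name. -/
inductive ReidemeisterMove (X : Type*) where
  /-- creation of the crossing `x` -/
  | first (x : X)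
  /-- creation of the two crossings `x`, `y` -/
  | second (x y : X)
  /-- the third move on the crossings `a` (top over middle strand), `b` (top over bottom strand),
  `c` (middle over bottom strand) -/
  | third (a b c : X)

/-- The two letters `p`, `q`, in this order for `o = 1`, in the opposite order for `o = -1`. -/
def orderedPair {α : Type*} (o : ℤˣ) (p q : α) : List α := if o = 1 then [p, q] else [q, p]

/-- `m.Takes K K₁`: the move `m` transforms `K` into `K₁` (in the crossing-increasing direction for
the first and the second move; the decreasing moves are the inverse ones).

* first move: an isolated chord `x`, of any sign and direction, is added;
* second move: two chords `x`, `y` of opposite signs are added, with adjacent tails and adjacent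
  heads;
* third move: the adjacent ends on each of the top, middle and bottom strand change places. For three
  oriented strands in general position in the plane, with `sₐ`, `s_b`, `s_c` the signs of the
  crossings and `o₁ = 1` (resp. `o₂ = 1`, `o₃ = 1`) if the top strand meets `a` before `b` (resp. the
  middle one `a` before `c`, the bottom one `b` before `c`), and `-1` otherwise, the possible
  configurations are exactly those with `o₁ = η s_b`, `o₂ = η s_c`, `o₃ = η sₐ s_b s_c` for some
  `η = ±1`, and the move changes `η` to `-η`. The three strands can occur along the knot in either
  cyclic order. -/
def ReidemeisterMove.Takes {X : Type*} :
    ReidemeisterMove X → GaussDiagram X → GaussDiagram X → Prop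
  | .first x, K, K₁ => ∃ (o : Bool) (s : ℤˣ) (w : List (ChordEnd X)),
      K.core = (w : Cycle (ChordEnd X)) ∧
      K₁.core = (([⟨x, o, s⟩, ⟨x, !o, s⟩] ++ w : List (ChordEnd X)) : Cycle (ChordEnd X))
  | .second x y, K, K₁ => x ≠ y ∧ ∃ (s o o' : ℤˣ) (w₁ w₂ : List (ChordEnd X)),
      K.core = ((w₁ ++ w₂ : List (ChordEnd X)) : Cycle (ChordEnd X)) ∧
      K₁.core = ((orderedPair o ⟨x, true, s⟩ ⟨y, true, -s⟩ ++ w₁ ++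
        orderedPair o' ⟨x, false, s⟩ ⟨y, false, -s⟩ ++ w₂ : List (ChordEnd X)) :
          Cycle (ChordEnd X))
  | .third a b c, K, K₁ => a ≠ b ∧ a ≠ c ∧ b ≠ c ∧
      ∃ (sₐ s_b s_c η : ℤˣ) (w₁ w₂ w₃ : List (ChordEnd X)),
        let top (η : ℤˣ) := orderedPair (η * s_b) (⟨a, true, sₐ⟩ : ChordEnd X) ⟨b, true, s_b⟩
        let mid (η : ℤˣ) := orderedPair (η * s_c) (⟨a, false, sₐ⟩ : ChordEnd X) ⟨c, true, s_c⟩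
        let bot (η : ℤˣ) :=
          orderedPair (η * sₐ * s_b * s_c) (⟨b, false, s_b⟩ : ChordEnd X) ⟨c, false, s_c⟩
        (K.core = ((top η ++ w₁ ++ mid η ++ w₂ ++ bot η ++ w₃ : List (ChordEnd X)) :
            Cycle (ChordEnd X)) ∧
          K₁.core = ((top (-η) ++ w₁ ++ mid (-η) ++ w₂ ++ bot (-η) ++ w₃ : List (ChordEnd X)) :
            Cycle (ChordEnd X))) ∨
        (K.core = ((top η ++ w₁ ++ bot η ++ w₂ ++ mid η ++ w₃ : List (ChordEnd X)) :
            Cycle (ChordEnd X)) ∧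
          K₁.core = ((top (-η) ++ w₁ ++ bot (-η) ++ w₂ ++ mid (-η) ++ w₃ : List (ChordEnd X)) :
            Cycle (ChordEnd X)))

/-! The relations make the parity group a vector space over `ZMod 2`: the span of the crossings
modulo the span of the cycle sums. So a crossing vanishes there exactly when some 2-colouring of the
pasted cycles, seen as a colouring of corners constant along boundary components, has corner sum 1
at this crossing and 0 at all others (`isEven_iff`). Read along the Gauss word, a colouring is a
sequence of edge states, the colours left and right of each edge (`Transit`), and a Reidemeister
move becomes a finite check at the crossings taking part.

For (1): colouring only the monogon of a kink by 1 shows that the new crossing is even. Colouring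
only the bigon of a second move shows that its two crossings are equal in the group, so both survive
or both are deleted. Colouring only the triangle of a third move shows that its three crossings add
up to zero: all three are even, or at most one is, and then no strand keeps both its ends and the
exchange is invisible. It remains to carry colourings across the move without changing the outer
states or the sums. For the second move this requires that the sides of the two edges facing each
other have the same colour. Equality of the genera guarantees it: otherwise a dimension count gives
too few pasted cycles after the move (`side_eq_of_eulerChar_eq`).

For (2): with n > 0 crossings and F pasted cycles the Euler characteristic is F - n. The diagram `l
K` is equivalent to `K` iff all crossings are even, i.e. iff the corner-sum map from the
F-dimensional space of colourings to the n-dimensional space of functions on crossings is onto. Its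
kernel contains the constant 1 and has dimension at most 2, being determined by the state of one
edge. Hence surjectivity forces F > n and so genus 0, while F = n + 2 forces surjectivity. -/

/-! ### Corner colourings read along a Gauss word. -/

namespace ChordEnd

variable {X : Type*}

/-- The counterclockwise rotation of half-edges, independently of a diagram. -/
def turn (d : ChordEnd X × Bool) : ChordEnd X × Bool :=
  (d.1.opposite, if (d.1.isOver = true ↔ d.1.sign = 1) then d.2 else !d.2)

@[simp] theorem opposite_opposite (p : ChordEnd X) : p.opposite.opposite = p := by
  simp [opposite]

end ChordEnd

/-- The values of a colouring to the left and to the right of an edge. -/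
abbrev EdgeState : Type := ZMod 2 × ZMod 2

section Coloring

variable {X : Type*}

/-- The colours to the left and to the right of the edge by which the knot arrives at `p`, for a
colouring `c` of the corners (the corner of a half-edge is the one clockwise from it). -/
def arrive (c : ChordEnd X × Bool → ZMod 2) (p : ChordEnd X) : EdgeState :=
  (c (p, false), c (ChordEnd.turn (p, false)))

/-- The colours to the left and to the right of the edge by which the knot leaves `p`. -/
def leave (c : ChordEnd X × Bool → ZMod 2) (p : ChordEnd X) : EdgeState :=
  (c (ChordEnd.turn (p, true)), c (p, true))

/-- The sum of the colours of the four corners at the crossing of `p`. -/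
def vertexSum (c : ChordEnd X × Bool → ZMod 2) (p : ChordEnd X) : ZMod 2 :=
  c (p, true) + c (p, false) + (c (p.opposite, true) + c (p.opposite, false))

/-- The edge colours along the word `w` are consistent, from the state `s` to the state `t`. -/
def Transit (c : ChordEnd X × Bool → ZMod 2) : List (ChordEnd X) → EdgeState → EdgeState → Prop
  | [], s, t => s = t
  | p :: w, s, t => arrive c p = s ∧ Transit c w (leave c p) t

theorem transit_append (c : ChordEnd X × Bool → ZMod 2) (u v : List (ChordEnd X))
    (s t : EdgeState) : Transit c (u ++ v) s t ↔ ∃ m, Transit c u s m ∧ Transit c v m t := by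
  induction u generalizing s with
  | nil => simp [Transit]
  | cons p u ih => simp [Transit, ih, and_assoc]

/-- Cutting the core circle at one point turns cyclic consistency into a transit returning to its
initial state. For the empty word every state qualifies, so states can be compared only along
nonempty words. -/
theorem chain_iff_transit (c : ChordEnd X × Bool → ZMod 2) (w : List (ChordEnd X)) :
    Cycle.Chain (fun p q => leave c p = arrive c q) (w : Cycle (ChordEnd X)) ↔
      ∃ s, Transit c w s s := by
  have key : ∀ (q : ChordEnd X) (l : List (ChordEnd X)) (p : ChordEnd X),
      List.IsChain (fun p q => leave c p = arrive c q) (p :: (l ++ [q])) ↔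
        Transit c l (leave c p) (arrive c q) := by
    intro q l
    induction l with
    | nil => simp [Transit]
    | cons r l ih => intro p; simp [Transit, ih, eq_comm (a := arrive c r)]
  cases w with
  | nil => simp [Transit]
  | cons p w => rw [Cycle.chain_coe_cons, key]; simp [Transit]

theorem transit_congr {c c' : ChordEnd X × Bool → ZMod 2} {w : List (ChordEnd X)}
    (h : ∀ p ∈ w, ∀ b, c (p, b) = c' (p, b) ∧ c (p.opposite, b) = c' (p.opposite, b))
    {s t : EdgeState} : Transit c w s t ↔ Transit c' w s t := by
  induction w generalizing s with
  | nil => rfl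
  | cons p w ih =>
    simp only [Transit]
    rw [ih fun q hq => h q (by simp [hq])]
    simp [arrive, leave, ChordEnd.turn, h p]

theorem vertexSum_congr {c c' : ChordEnd X × Bool → ZMod 2} {p : ChordEnd X}
    (h : ∀ b, c (p, b) = c' (p, b) ∧ c (p.opposite, b) = c' (p.opposite, b)) :
    vertexSum c p = vertexSum c' p := by
  simp [vertexSum, h]

theorem vertexSum_opposite (c : ChordEnd X × Bool → ZMod 2) (p : ChordEnd X) :
    vertexSum c p.opposite = vertexSum c p := by
  simp [vertexSum, add_comm]

theorem transit_zero (w : List (ChordEnd X)) : Transit 0 w 0 0 := by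
  induction w with
  | nil => rfl
  | cons p w ih => exact ⟨rfl, ih⟩

theorem vertexSum_add (c c' : ChordEnd X × Bool → ZMod 2) (p : ChordEnd X) :
    vertexSum (c + c') p = vertexSum c p + vertexSum c' p := by
  simp only [vertexSum, Pi.add_apply]; ring

open Classical in
/-- Change the colours at the crossing `x`. -/
noncomputable def recolor (x : X) (v : Bool → Bool → ZMod 2) (c : ChordEnd X × Bool → ZMod 2) :
    ChordEnd X × Bool → ZMod 2 :=
  fun d => if d.1.crossing = x then v d.1.isOver d.2 else c d

theorem recolor_self (x : X) (v : Bool → Bool → ZMod 2) (c : ChordEnd X × Bool → ZMod 2)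
    (o : Bool) (s : ℤˣ) (b : Bool) : recolor x v c (⟨x, o, s⟩, b) = v o b := if_pos rfl

theorem recolor_of_ne {x : X} (v : Bool → Bool → ZMod 2) (c : ChordEnd X × Bool → ZMod 2)
    {d : ChordEnd X × Bool} (h : d.1.crossing ≠ x) : recolor x v c d = c d := if_neg h

/-- The colours at a crossing of sign `s` for which the half-edges `(over, bo)` and `(under, bu)`
have the given colours clockwise and counterclockwise from them, and the sum is `σ`. -/
def fill (s : ℤˣ) (bo bu : Bool) (o u : EdgeState) (σ : ZMod 2) : Bool → Bool → ZMod 2 :=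
  let adj : Bool := bu == (if s = 1 then bo else !bo)
  fun isOver b =>
    if isOver then
      if b = bo then o.1 else if adj then u.2 else σ + o.1 + o.2 + u.1
    else
      if b = bu then u.1 else if adj then σ + o.1 + u.1 + u.2 else o.2

/-- The colours clockwise and counterclockwise from an outer half-edge of a piece of the knot that
begins with the state `e` and ends with the state `f`; the half-edge is the last one if `b`. -/
def outerState (e f : EdgeState) (b : Bool) : EdgeState := if b then f.swap else e

/-- The colour on one side of an edge: on the right for `s = 1`, on the left for `s = -1`. -/
def EdgeState.side (e : EdgeState) (s : ℤˣ) : ZMod 2 := if s = 1 then e.2 else e.1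

theorem recolor_ne {x y : X} (h : y ≠ x) (v : Bool → Bool → ZMod 2)
    (c : ChordEnd X × Bool → ZMod 2) (o : Bool) (s : ℤˣ) (b : Bool) :
    recolor x v c (⟨y, o, s⟩, b) = c (⟨y, o, s⟩, b) := if_neg h

end Coloring

/-! ### Colourings near the crossings of a single move. -/

section LocalMoves

variable {X : Type*}

/-- At a kink two opposite corners lie in the same region and cancel; the other two are the monogon
and a corner between the two outer half-edges. The colour of the monogon is therefore free to
produce any sum. -/
theorem exists_recolor_first (x : X) (o : Bool) (s : ℤˣ) (c : ChordEnd X × Bool → ZMod 2)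
    (e : EdgeState) (σ : ZMod 2) : ∃ v : Bool → Bool → ZMod 2,
      Transit (recolor x v c) [⟨x, o, s⟩, ⟨x, !o, s⟩] e e ∧
      vertexSum (recolor x v c) ⟨x, o, s⟩ = σ := by
  obtain ⟨l, r⟩ := e
  -- The outer half-edges are the arriving one of the first passage and the leaving one of the
  -- second; seen from the crossing, the sides of the latter are interchanged.
  refine ⟨if o then fill s false true (l, r) (r, l) σ else fill s true false (r, l) (l, r) σ, ?_⟩
  rcases Int.units_eq_one_or s with rfl | rfl <;> cases o <;>
  · simp [Transit, arrive, leave, ChordEnd.turn, ChordEnd.opposite, recolor_self, fill, vertexSum]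
    grind

theorem transit_first (x : X) (o : Bool) (s : ℤˣ) (c : ChordEnd X × Bool → ZMod 2)
    (e e' : EdgeState) (h : Transit c [⟨x, o, s⟩, ⟨x, !o, s⟩] e e')
    (h0 : vertexSum c ⟨x, o, s⟩ = 0) : e = e' := by
  obtain ⟨l, r⟩ := e
  obtain ⟨l', r'⟩ := e'
  rcases Int.units_eq_one_or s with rfl | rfl <;> cases o <;>
  · simp [Transit, arrive, leave, ChordEnd.turn, ChordEnd.opposite, vertexSum] at h h0 ⊢
    grind

/-- The outer half-edges at each of the two crossings meet in a corner of the region between the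
strands, so the facing sides must have equal colours: this is `h`. The fourth corner at each
crossing is the bigon, whose colour is determined by `σ`, in the same way at both. -/
theorem exists_recolor_second {x y : X} (hxy : x ≠ y) (o o' s : ℤˣ)
    (c : ChordEnd X × Bool → ZMod 2) (e e' : EdgeState) (σ : ZMod 2)
    (h : e.side (s * o') = e'.side (-(s * o))) :
    ∃ v v' : Bool → Bool → ZMod 2,
      Transit (recolor x v (recolor y v' c)) (orderedPair o ⟨x, true, s⟩ ⟨y, true, -s⟩) e e ∧
      Transit (recolor x v (recolor y v' c)) (orderedPair o' ⟨x, false, s⟩ ⟨y, false, -s⟩) e' e' ∧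
      vertexSum (recolor x v (recolor y v' c)) ⟨x, true, s⟩ = σ ∧
      vertexSum (recolor x v (recolor y v' c)) ⟨y, true, -s⟩ = σ := by
  obtain ⟨l, r⟩ := e
  obtain ⟨l', r'⟩ := e'
  refine ⟨fill s (o = -1) (o' = -1) (outerState (l, r) (l, r) (o = -1))
      (outerState (l', r') (l', r') (o' = -1)) σ,
    fill (-s) (o = 1) (o' = 1) (outerState (l, r) (l, r) (o = 1))
      (outerState (l', r') (l', r') (o' = 1)) σ, ?_⟩
  rcases Int.units_eq_one_or s with rfl | rfl <;> rcases Int.units_eq_one_or o with rfl | rfl <;>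
    rcases Int.units_eq_one_or o' with rfl | rfl <;>
  · simp [Transit, arrive, leave, ChordEnd.turn, ChordEnd.opposite, recolor_self,
      recolor_ne hxy.symm, fill, vertexSum, orderedPair, EdgeState.side, outerState] at h ⊢
    grind

/-- The crossings share the bigon and the two regions beyond the strands. Equal sums thus force
equal colours on the two parts into which the bigon cuts the region between the strands. -/
theorem transit_second {x y : X} (o o' : ℤˣ) (s : ℤˣ) (c : ChordEnd X × Bool → ZMod 2)
    (e e₁ e' e₁' : EdgeState)
    (h : Transit c (orderedPair o ⟨x, true, s⟩ ⟨y, true, -s⟩) e e₁)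
    (h' : Transit c (orderedPair o' ⟨x, false, s⟩ ⟨y, false, -s⟩) e' e₁')
    (hs : vertexSum c ⟨x, true, s⟩ = vertexSum c ⟨y, true, -s⟩) :
    e = e₁ ∧ e' = e₁' ∧ e.side (s * o') = e'.side (-(s * o)) := by
  obtain ⟨l, r⟩ := e
  obtain ⟨l', r'⟩ := e'
  obtain ⟨l₁, r₁⟩ := e₁
  obtain ⟨l₁', r₁'⟩ := e₁'
  rcases Int.units_eq_one_or s with rfl | rfl <;> rcases Int.units_eq_one_or o with rfl | rfl <;>
    rcases Int.units_eq_one_or o' with rfl | rfl <;>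
  · simp [Transit, arrive, leave, ChordEnd.turn, ChordEnd.opposite, vertexSum,
      orderedPair, EdgeState.side] at h h' hs ⊢
    grind

theorem transit_second_zero {x y : X} (o o' : ℤˣ) (s : ℤˣ) (c : ChordEnd X × Bool → ZMod 2)
    (h : Transit c (orderedPair o ⟨x, true, s⟩ ⟨y, true, -s⟩) 0 0)
    (h' : Transit c (orderedPair o' ⟨x, false, s⟩ ⟨y, false, -s⟩) 0 0)
    (hx : vertexSum c ⟨x, true, s⟩ = 0) (hy : vertexSum c ⟨y, true, -s⟩ = 0) (i b : Bool) :
    c (⟨x, i, s⟩, b) = 0 ∧ c (⟨y, i, -s⟩, b) = 0 := by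
  rcases Int.units_eq_one_or s with rfl | rfl <;> rcases Int.units_eq_one_or o with rfl | rfl <;>
    rcases Int.units_eq_one_or o' with rfl | rfl <;>
  · simp [Transit, arrive, leave, ChordEnd.turn, ChordEnd.opposite, vertexSum,
      orderedPair, Prod.ext_iff] at h h' hx hy ⊢
    cases i <;> cases b <;> grind

/-- Six outer sectors surround the triangle. Each crossing touches the triangle and three
consecutive sectors before the move, and the triangle and the complementary three after it. To keep
all three sums, the triangle must change its colour by the total of the six sectors, which is the
same requirement at every crossing. -/
theorem exists_recolor_third {x y z : X} (hxy : x ≠ y) (hxz : x ≠ z) (hyz : y ≠ z)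
    (sx sy sz η : ℤˣ)
    (c : ChordEnd X × Bool → ZMod 2) (e₁ f₁ e₂ f₂ e₃ f₃ : EdgeState)
    (h₁ : Transit c (orderedPair (η * sy) ⟨x, true, sx⟩ ⟨y, true, sy⟩) e₁ f₁)
    (h₂ : Transit c (orderedPair (η * sz) ⟨x, false, sx⟩ ⟨z, true, sz⟩) e₂ f₂)
    (h₃ : Transit c (orderedPair (η * sx * sy * sz) ⟨y, false, sy⟩ ⟨z, false, sz⟩) e₃ f₃) :
    ∃ u v w : Bool → Bool → ZMod 2,
      let c' := recolor x u (recolor y v (recolor z w c))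
      Transit c' (orderedPair (-η * sy) ⟨x, true, sx⟩ ⟨y, true, sy⟩) e₁ f₁ ∧
      Transit c' (orderedPair (-η * sz) ⟨x, false, sx⟩ ⟨z, true, sz⟩) e₂ f₂ ∧
      Transit c' (orderedPair (-η * sx * sy * sz) ⟨y, false, sy⟩ ⟨z, false, sz⟩) e₃ f₃ ∧
      vertexSum c' ⟨x, true, sx⟩ = vertexSum c ⟨x, true, sx⟩ ∧
      vertexSum c' ⟨y, true, sy⟩ = vertexSum c ⟨y, true, sy⟩ ∧
      vertexSum c' ⟨z, true, sz⟩ = vertexSum c ⟨z, true, sz⟩ := by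
  -- The move reverses the order on every strand: an end that came first before the move comes
  -- second after it, so its outer half-edge is then the leaving one.
  refine ⟨fill sx (η * sy = 1) (η * sz = 1) (outerState e₁ f₁ (η * sy = 1))
      (outerState e₂ f₂ (η * sz = 1)) (vertexSum c ⟨x, true, sx⟩),
    fill sy (η * sy = -1) (η * sx * sy * sz = 1) (outerState e₁ f₁ (η * sy = -1))
      (outerState e₃ f₃ (η * sx * sy * sz = 1)) (vertexSum c ⟨y, true, sy⟩),
    fill sz (η * sz = -1) (η * sx * sy * sz = -1) (outerState e₂ f₂ (η * sz = -1))
      (outerState e₃ f₃ (η * sx * sy * sz = -1)) (vertexSum c ⟨z, true, sz⟩), ?_⟩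
  obtain ⟨_, _⟩ := e₁
  obtain ⟨_, _⟩ := f₁
  obtain ⟨_, _⟩ := e₂
  obtain ⟨_, _⟩ := f₂
  obtain ⟨_, _⟩ := e₃
  obtain ⟨_, _⟩ := f₃
  rcases Int.units_eq_one_or sx with rfl | rfl <;> rcases Int.units_eq_one_or sy with rfl | rfl <;>
    rcases Int.units_eq_one_or sz with rfl | rfl <;> rcases Int.units_eq_one_or η with rfl | rfl <;>
  · simp [Transit, arrive, leave, ChordEnd.turn, ChordEnd.opposite, recolor_self,
      recolor_ne hxy.symm, recolor_ne hxz.symm, recolor_ne hyz.symm, fill, vertexSum,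
      orderedPair, outerState] at h₁ h₂ h₃ ⊢
    grind

/-- Only the triangle is coloured 1; it has one corner at each of the three crossings. -/
theorem exists_recolor_triangle {x y z : X} (hxy : x ≠ y) (hxz : x ≠ z) (hyz : y ≠ z)
    (sx sy sz η : ℤˣ)
    (c : ChordEnd X × Bool → ZMod 2) :
    ∃ u v w : Bool → Bool → ZMod 2,
      let c' := recolor x u (recolor y v (recolor z w c))
      Transit c' (orderedPair (η * sy) ⟨x, true, sx⟩ ⟨y, true, sy⟩) 0 0 ∧
      Transit c' (orderedPair (η * sz) ⟨x, false, sx⟩ ⟨z, true, sz⟩) 0 0 ∧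
      Transit c' (orderedPair (η * sx * sy * sz) ⟨y, false, sy⟩ ⟨z, false, sz⟩) 0 0 ∧
      vertexSum c' ⟨x, true, sx⟩ = 1 ∧
      vertexSum c' ⟨y, true, sy⟩ = 1 ∧
      vertexSum c' ⟨z, true, sz⟩ = 1 := by
  refine ⟨fill sx (η * sy = -1) (η * sz = -1) 0 0 1,
    fill sy (η * sy = 1) (η * sx * sy * sz = -1) 0 0 1,
    fill sz (η * sz = 1) (η * sx * sy * sz = 1) 0 0 1, ?_⟩
  rcases Int.units_eq_one_or sx with rfl | rfl <;> rcases Int.units_eq_one_or sy with rfl | rfl <;>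
    rcases Int.units_eq_one_or sz with rfl | rfl <;> rcases Int.units_eq_one_or η with rfl | rfl <;>
    simp [Transit, arrive, leave, ChordEnd.turn, ChordEnd.opposite, recolor_self,
      recolor_ne hxy.symm, recolor_ne hxz.symm, recolor_ne hyz.symm, fill, vertexSum,
      orderedPair]

end LocalMoves

theorem Cycle.chain_iff_next {α : Type*} [DecidableEq α] (r : α → α → Prop) (s : Cycle α)
    (hs : s.Nodup) : s.Chain r ↔ ∀ x (hx : x ∈ s), r x (s.next hs x hx) := by
  revert hs
  refine Quotient.inductionOn' s fun w => ?_
  intro hs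
  change Cycle.Chain r (w : Cycle α) ↔ ∀ x (hx : x ∈ w), r x (w.next x hx)
  have hs : w.Nodup := hs
  cases w with
  | nil => simp
  | cons a l =>
    rw [Cycle.chain_coe_cons, List.isChain_iff_getElem]
    -- The closed-up list `a :: (l ++ [a])` is compared with `a :: l`, indices being taken modulo
    -- the length.
    have h₀ : ∀ i (hi : i < (a :: l).length), (a :: (l ++ [a]))[i]'(by simp at hi ⊢; omega) =
        (a :: l)[i] := by
      intro i hi
      cases i with
      | zero => rfl
      | succ i => simp only [List.length_cons] at hi; simp [(by omega : i < l.length)]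
    have h₁ : ∀ i (hi : i < (a :: l).length), (a :: (l ++ [a]))[i + 1]'(by simp at hi ⊢; omega) =
        (a :: l)[(i + 1) % (a :: l).length]'(Nat.mod_lt _ (by simp)) := by
      intro i hi
      rcases Nat.lt_or_eq_of_le (Nat.succ_le_of_lt hi) with h | h
      · simp only [Nat.mod_eq_of_lt h]
        exact h₀ _ h
      · have h : i = l.length := by simpa using h
        subst h
        simp
    constructor
    · intro h x hx
      obtain ⟨i, hi, rfl⟩ := List.getElem_of_mem hx
      rw [List.next_getElem _ hs, ← h₀ i hi, ← h₁ i hi]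
      exact h i (by simp at hi ⊢; omega)
    · intro h i hi
      have hi : i < (a :: l).length := by simp at hi ⊢; omega
      have := h _ (List.getElem_mem hi)
      rw [List.next_getElem _ hs] at this
      rwa [h₀ i hi, h₁ i hi]

/-! ### Ends, crossings and corners of a Gauss diagram. -/

namespace GaussDiagram

variable {X : Type*} (K : GaussDiagram X)

/-- A colouring of the corners that is constant along the pasted cycles. -/
def IsColoring (c : ChordEnd X × Bool → ZMod 2) : Prop :=
  K.core.Chain fun p q => leave c p = arrive c q

def HalfEdge.val {K : GaussDiagram X} (d : K.HalfEdge) : ChordEnd X × Bool := (d.1.1, d.2)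

theorem isColoring_iff_succ (c : ChordEnd X × Bool → ZMod 2) :
    K.IsColoring c ↔ ∀ p : K.End, leave c p.1 = arrive c (K.succ p).1 := by
  classical
  rw [IsColoring, Cycle.chain_iff_next _ _ K.nodup_core, Subtype.forall]
  simp only [succ, Equiv.coe_fn_mk]

/-- A step from a leaving half-edge follows the right side of its edge, and a step from an arriving
one follows the left side backwards. The two components of the edge states thus account for all
steps. -/
theorem isColoring_iff_step (c : ChordEnd X × Bool → ZMod 2) :
    K.IsColoring c ↔ ∀ d : K.HalfEdge, c (K.boundaryStep d).val = c d.val := by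
  rw [isColoring_iff_succ]
  constructor
  · rintro h ⟨p, _ | _⟩
    · have := congrArg Prod.fst (h (K.succ.symm p))
      simp only [leave, arrive, Equiv.apply_symm_apply] at this
      exact this
    · exact (congrArg Prod.snd (h p)).symm
  · intro h p
    refine Prod.ext ?_ (h (p, true)).symm
    have := h (K.succ p, false)
    simp only [boundaryStep, Equiv.trans_apply, otherHalf, Equiv.coe_fn_mk, Bool.false_eq_true,
      if_false, Equiv.symm_apply_apply] at this
    exact this

theorem end_ext {p q : K.End} (h : p.toCrossing = q.toCrossing) (h' : p.1.isOver = q.1.isOver) :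
    p = q := by
  obtain ⟨w, hw⟩ := Quot.exists_rep K.core
  have hn := K.nodup_ends
  obtain ⟨p, hp⟩ := p
  obtain ⟨q, hq⟩ := q
  rw [← hw] at hn hp hq
  exact Subtype.ext
    (List.inj_on_of_nodup_map hn hp hq (Prod.ext (congrArg Subtype.val h) h'))

theorem end_eq_or {p q : K.End} (h : p.toCrossing = q.toCrossing) : p = q ∨ p = K.opp q := by
  by_cases h' : p.1.isOver = q.1.isOver
  · exact .inl (K.end_ext h h')
  · refine .inr (K.end_ext h ?_)
    simp only [opp, ChordEnd.opposite]
    revert h'; cases p.1.isOver <;> cases q.1.isOver <;> simp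

theorem opp_ne (p : K.End) : K.opp p ≠ p := by
  intro h
  have := congrArg (fun p => p.1.isOver) h
  simp [opp, ChordEnd.opposite] at this

theorem card_end : Nat.card K.End = K.core.length := by
  classical
  have hn := K.nodup_core
  unfold End
  revert hn
  refine Quotient.inductionOn' K.core fun w => ?_
  intro hn
  change Nat.card {p // p ∈ w} = w.length
  rw [← List.toFinset_card_of_nodup hn]
  exact Nat.subtype_card _ (by simp)

theorem length_core : K.core.length = 2 * Nat.card K.Crossing := by
  rw [← card_end, mul_comm, ← (by simp : Nat.card Bool = 2), ← Nat.card_prod]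
  refine Nat.card_congr (Equiv.ofBijective (fun p : K.End => (p.toCrossing, p.1.isOver)) ⟨?_, ?_⟩)
  · intro p q h
    simp only [Prod.mk.injEq] at h
    exact K.end_ext h.1 h.2
  · rintro ⟨⟨_, p, hp, rfl⟩, b⟩
    by_cases h : p.isOver = b
    · exact ⟨⟨p, hp⟩, Prod.ext rfl h⟩
    · refine ⟨K.opp ⟨p, hp⟩, Prod.ext rfl ?_⟩
      simp only [opp, ChordEnd.opposite]
      revert h; cases p.isOver <;> cases b <;> simp

instance : Finite K.Crossing :=
  Finite.of_surjective (End.toCrossing (K := K)) fun ⟨_, p, hp, h⟩ => ⟨⟨p, hp⟩, Subtype.ext h⟩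

/-- The graph is four-valent, so it has twice as many edges as crossings. -/
theorem eulerChar_of_ne_nil (h : K.core ≠ Cycle.nil) :
    K.eulerChar = (Nat.card K.PastedCycle : ℤ) - Nat.card K.Crossing := by
  rw [eulerChar, if_neg h, length_core]
  push_cast
  ring

open Classical in
theorem sum_corners (c : ChordEnd X × Bool → ZMod 2) (p : K.End) :
    ∑ d : K.HalfEdge with d.1.toCrossing = p.toCrossing, c d.val = vertexSum c p.1 := by
  have : Fintype K.End := Fintype.ofFinite _
  have h : (Finset.univ.filter fun d : K.HalfEdge => d.1.toCrossing = p.toCrossing) =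
      ({p, K.opp p} : Finset K.End) ×ˢ (Finset.univ : Finset Bool) := by
    ext d
    simp only [Finset.mem_filter, Finset.mem_univ, true_and, Finset.mem_product, Finset.mem_insert,
      Finset.mem_singleton, and_true]
    constructor
    · exact K.end_eq_or
    · rintro (h | h) <;> rw [h]; rfl
  rw [h, Finset.sum_product, Finset.sum_pair (K.opp_ne p).symm]
  simp [vertexSum, HalfEdge.val, opp]
end GaussDiagram

/-! ### Colourings and the parity group. -/

namespace GaussDiagram

variable {X : Type*} (K : GaussDiagram X)

/-- The colourings of the pasted cycles, as functions that vanish outside the diagram. -/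
def colorings : Submodule (ZMod 2) (ChordEnd X × Bool → ZMod 2) where
  carrier := {c | (∀ d : K.HalfEdge, c (K.boundaryStep d).val = c d.val) ∧
    ∀ d, d.1 ∉ K.core → c d = 0}
  add_mem' h h' := ⟨fun d => by simp [h.1 d, h'.1 d], fun d hd => by simp [h.2 d hd, h'.2 d hd]⟩
  zero_mem' := ⟨fun _ => rfl, fun _ _ => rfl⟩
  smul_mem' a c h := ⟨fun d => by simp [h.1 d], fun d hd => by simp [h.2 d hd]⟩

theorem mem_colorings {c : ChordEnd X × Bool → ZMod 2} :
    c ∈ K.colorings ↔ K.IsColoring c ∧ ∀ d, d.1 ∉ K.core → c d = 0 := by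
  rw [isColoring_iff_step]; rfl

variable {K} in
theorem IsColoring.eq_of_sameCycle {c : ChordEnd X × Bool → ZMod 2} (h : K.IsColoring c)
    {d e : K.HalfEdge} (hde : K.boundaryStep.SameCycle d e) : c d.val = c e.val := by
  rw [isColoring_iff_step] at h
  have hn : ∀ (n : ℕ) (d : K.HalfEdge), c ((K.boundaryStep ^ n) d).val = c d.val := by
    intro n
    induction n with
    | zero => simp
    | succ n ih => intro d; rw [pow_succ', Equiv.Perm.mul_apply, h, ih]
  obtain ⟨n, rfl⟩ := hde.exists_nat_pow_eq
  exact (hn n d).symm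

open Classical in
/-- The colouring given by colours of the pasted cycles. -/
noncomputable def colorPasted (f : K.PastedCycle → ZMod 2) : ChordEnd X × Bool → ZMod 2 :=
  fun d => if h : d.1 ∈ K.core then f (Quotient.mk _ ((⟨d.1, h⟩, d.2) : K.HalfEdge)) else 0

theorem colorPasted_val (f : K.PastedCycle → ZMod 2) (d : K.HalfEdge) :
    K.colorPasted f d.val = f (Quotient.mk _ d) := dif_pos d.1.2

theorem isColoring_colorPasted (f : K.PastedCycle → ZMod 2) : K.IsColoring (K.colorPasted f) := by
  rw [isColoring_iff_step]
  intro d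
  rw [colorPasted_val, colorPasted_val]
  refine congrArg f (Quotient.sound ?_)
  exact Equiv.Perm.sameCycle_apply_left.2 (Equiv.Perm.SameCycle.refl _ _)

/-- The colours of the pasted cycles in a colouring. -/
noncomputable def IsColoring.onPasted {K : GaussDiagram X} {c : ChordEnd X × Bool → ZMod 2}
    (h : K.IsColoring c) : K.PastedCycle → ZMod 2 :=
  Quotient.lift (fun d : K.HalfEdge => c d.val) fun _ _ => h.eq_of_sameCycle

/-- Colourings are functions on the set of pasted cycles. -/
noncomputable def coloringsEquiv : (K.PastedCycle → ZMod 2) ≃ₗ[ZMod 2] K.colorings where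
  toFun f := ⟨K.colorPasted f, K.mem_colorings.2
    ⟨K.isColoring_colorPasted f, fun _ hd => dif_neg hd⟩⟩
  map_add' f g := by
    ext d
    simp only [colorPasted, Submodule.coe_add, Pi.add_apply]
    split_ifs <;> simp
  map_smul' a f := by
    ext d
    simp only [colorPasted, Submodule.coe_smul, Pi.smul_apply, RingHom.id_apply]
    split_ifs <;> simp
  invFun c := (K.mem_colorings.1 c.2).1.onPasted
  left_inv f := by
    ext C
    induction C using Quotient.inductionOn with
    | _ d => exact K.colorPasted_val f d
  right_inv c := by
    ext d
    by_cases h : d.1 ∈ K.core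
    · exact dif_pos h
    · exact (dif_neg h).trans ((K.mem_colorings.1 c.2).2 d h).symm

instance : Module.Finite (ZMod 2) K.colorings := Module.Finite.equiv K.coloringsEquiv

theorem finrank_colorings : Module.finrank (ZMod 2) K.colorings = Nat.card K.PastedCycle := by
  have := Fintype.ofFinite K.PastedCycle
  rw [← K.coloringsEquiv.finrank_eq, Module.finrank_fintype_fun_eq_card, Nat.card_eq_fintype_card]

open Classical in
/-- The sums of the corner colours at the crossings. -/
noncomputable def crossingSum : (ChordEnd X × Bool → ZMod 2) →ₗ[ZMod 2] (K.Crossing → ZMod 2) where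
  toFun c z := ∑ d : K.HalfEdge with d.1.toCrossing = z, c d.val
  map_add' c c' := by ext z; simp [Finset.sum_add_distrib]
  map_smul' a c := by ext z; simp [Finset.mul_sum]

theorem crossingSum_toCrossing (c : ChordEnd X × Bool → ZMod 2) (p : K.End) :
    K.crossingSum c p.toCrossing = vertexSum c p.1 := K.sum_corners c p

open Classical in
-- Modulo 2 the relations `2 • a` disappear and a cycle sum becomes the corner sums of the indicator
-- colouring of that cycle; colourings are closed under addition.
theorem exists_coloring_of_mem_closure {r : FreeAbelianGroup K.Crossing}
    (hr : r ∈ AddSubgroup.closure K.parityRelations) : ∃ c, K.IsColoring c ∧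
      K.crossingSum c = FreeAbelianGroup.lift (fun a => Pi.single a (1 : ZMod 2)) r := by
  suffices ∃ c ∈ K.colorings,
      K.crossingSum c = FreeAbelianGroup.lift (fun a => Pi.single a (1 : ZMod 2)) r by
    obtain ⟨c, hc, h⟩ := this
    exact ⟨c, (K.mem_colorings.1 hc).1, h⟩
  induction hr using AddSubgroup.closure_induction with
  | mem r hr =>
    rcases hr with ⟨a, rfl⟩ | ⟨C, rfl⟩
    · refine ⟨0, zero_mem _, ?_⟩
      rw [map_zero, map_nsmul, FreeAbelianGroup.lift_apply_of]
      ext z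
      simp [(by decide : (2 : ZMod 2) = 0)]
    · refine ⟨_, (K.coloringsEquiv (Pi.single C 1)).2, ?_⟩
      ext z
      simp only [cycleSum, map_sum, FreeAbelianGroup.lift_apply_of, Finset.sum_apply]
      change ∑ d : K.HalfEdge with d.1.toCrossing = z, K.colorPasted (Pi.single C 1) d.val = _
      simp only [colorPasted_val, Finset.sum_filter, Pi.single_apply]
      refine Finset.sum_congr rfl fun d _ => ?_
      split_ifs <;> simp_all
  | zero => exact ⟨0, zero_mem _, by simp⟩
  | add r r' _ _ h h' =>
    obtain ⟨c, hc, h⟩ := h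
    obtain ⟨c', hc', h'⟩ := h'
    exact ⟨c + c', add_mem hc hc', by rw [map_add, map_add, h, h']⟩
  | neg r _ h =>
    obtain ⟨c, hc, h⟩ := h
    exact ⟨-c, neg_mem hc, by rw [map_neg, map_neg, h]⟩

open Classical in
-- The corners are summed in two ways, with colours as coefficients: by crossings the total is
-- `K.parity a`, by pasted cycles it is a combination of relations.
theorem parity_eq_zero_of_coloring {c : ChordEnd X × Bool → ZMod 2} (hc : K.IsColoring c)
    (a : K.Crossing) (h : K.crossingSum c = Pi.single a 1) : K.parity a = 0 := by
  have h2 : ∀ x : K.ParityGroup, 2 • x = 0 := by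
    intro x
    obtain ⟨x, rfl⟩ := QuotientAddGroup.mk_surjective x
    induction x using FreeAbelianGroup.induction_on with
    | zero => simp
    | of x =>
      rw [← QuotientAddGroup.mk_nsmul, QuotientAddGroup.eq_zero_iff]
      exact AddSubgroup.subset_closure (.inl ⟨x, rfl⟩)
    | neg x h => rw [QuotientAddGroup.mk_neg, smul_neg, h, neg_zero]
    | add x y h h' => rw [QuotientAddGroup.mk_add, smul_add, h, h', add_zero]
  let _ : Module (ZMod 2) K.ParityGroup := AddCommGroup.zmodModule h2
  have : Fintype K.Crossing := Fintype.ofFinite _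
  have : Fintype K.PastedCycle := Fintype.ofFinite _
  have hC : ∀ C : K.PastedCycle,
      ∑ d : K.HalfEdge with (Quotient.mk _ d : K.PastedCycle) = C, K.parity d.1.toCrossing = 0 := by
    intro C
    have : (QuotientAddGroup.mk (K.cycleSum C) : K.ParityGroup) = 0 :=
      (QuotientAddGroup.eq_zero_iff _).2 (AddSubgroup.subset_closure (.inr ⟨C, rfl⟩))
    rw [← this]
    exact (map_sum (QuotientAddGroup.mk' (AddSubgroup.closure K.parityRelations)) _ _).symm
  calc K.parity a = ∑ z, K.crossingSum c z • K.parity z := by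
        rw [h, Finset.sum_eq_single a] <;> simp +contextual
    _ = ∑ z, ∑ d : K.HalfEdge with d.1.toCrossing = z, c d.val • K.parity d.1.toCrossing := by
        refine Finset.sum_congr rfl fun z _ => ?_
        simp only [crossingSum, LinearMap.coe_mk, AddHom.coe_mk, Finset.sum_smul]
        refine Finset.sum_congr rfl fun d hd => ?_
        rw [(Finset.mem_filter.1 hd).2]
    _ = ∑ d : K.HalfEdge, c d.val • K.parity d.1.toCrossing := Finset.sum_fiberwise _ _ _
    _ = ∑ C, ∑ d : K.HalfEdge with (Quotient.mk _ d : K.PastedCycle) = C,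
          c d.val • K.parity d.1.toCrossing := (Finset.sum_fiberwise _ _ _).symm
    _ = 0 := Finset.sum_eq_zero fun C _ => by
        rw [← smul_zero (hc.onPasted C), ← hC C, Finset.smul_sum]
        refine Finset.sum_congr rfl fun d hd => ?_
        rw [← (Finset.mem_filter.1 hd).2]
        rfl

open Classical in
theorem parity_eq_zero_iff (a : K.Crossing) :
    K.parity a = 0 ↔ ∃ c, K.IsColoring c ∧ K.crossingSum c = Pi.single a 1 := by
  constructor
  · intro h
    obtain ⟨c, hc, h⟩ := K.exists_coloring_of_mem_closure ((QuotientAddGroup.eq_zero_iff _).1 h)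
    exact ⟨c, hc, by rw [h, FreeAbelianGroup.lift_apply_of]⟩
  · rintro ⟨c, hc, h⟩
    exact K.parity_eq_zero_of_coloring hc a h

open Classical in
theorem isEven_iff (x : X) : K.IsEven x ↔ (∃ p ∈ K.core, p.crossing = x) ∧ ∃ c, K.IsColoring c ∧
    ∀ p ∈ K.core, vertexSum c p = if p.crossing = x then 1 else 0 := by
  have key : ∀ h : ∃ p ∈ K.core, p.crossing = x, (K.parity ⟨x, h⟩ = 0 ↔ ∃ c, K.IsColoring c ∧
      ∀ p ∈ K.core, vertexSum c p = if p.crossing = x then 1 else 0) := by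
    intro h
    rw [parity_eq_zero_iff]
    refine exists_congr fun c => and_congr_right fun _ => ?_
    rw [funext_iff]
    constructor
    · intro h' p hp
      rw [← K.crossingSum_toCrossing c ⟨p, hp⟩, h', Pi.single_apply]
      simp [End.toCrossing]
    · rintro h' ⟨_, p, hp, rfl⟩
      refine (K.crossingSum_toCrossing c ⟨p, hp⟩).trans ?_
      rw [h' p hp, Pi.single_apply]
      simp
  exact ⟨fun ⟨h, h'⟩ => ⟨h, (key h).1 h'⟩, fun ⟨h, h'⟩ => ⟨h, (key h).2 h'⟩⟩

end GaussDiagram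

/-! ### Diagrams all of whose crossings are even, and the genus. -/

namespace GaussDiagram

variable {X Y : Type*} (K : GaussDiagram X)

/-- All crossings are zero in the parity group. -/
def AllEven : Prop := ∀ p ∈ K.core, K.IsEven p.crossing

theorem l_core_eq {w : List (ChordEnd X)} (h : K.core = w) [DecidablePred K.IsEven] :
    K.l.core = (w.filter fun p => decide (K.IsEven p.crossing) : List (ChordEnd X)) := by
  change cyclicFilter _ K.core = _
  rw [h]
  refine congrArg _ (List.filter_congr fun p _ => ?_)
  congr

theorem allEven_of_length_le (h : K.core.length ≤ K.l.core.length) : K.AllEven := by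
  classical
  obtain ⟨w, hw⟩ := Quot.exists_rep K.core
  have hw : K.core = w := hw.symm
  rw [K.l_core_eq hw, hw, Cycle.length_coe, Cycle.length_coe] at h
  have := List.filter_eq_self.1 (List.filter_sublist.eq_of_length_le h)
  intro p hp
  rw [hw] at hp
  simpa using this p hp

theorem AllEven.l_eq {K : GaussDiagram X} (h : K.AllEven) : K.l = K := by
  classical
  obtain ⟨w, hw⟩ := Quot.exists_rep K.core
  have hw : K.core = w := hw.symm
  ext1
  rw [K.l_core_eq hw, hw, List.filter_eq_self.2]
  intro p hp
  simpa using h p (by rw [hw]; exact hp)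

theorem virtuallyEquivalent_refl : K.VirtuallyEquivalent K := by
  refine ⟨id, ?_⟩
  obtain ⟨w, hw⟩ := Quot.exists_rep K.core
  have hw : K.core = w := hw.symm
  rw [hw, Cycle.map_coe]
  exact congrArg _ (List.map_id _)

/-- The sums of colourings at the crossings. -/
noncomputable def coloringSum : K.colorings →ₗ[ZMod 2] (K.Crossing → ZMod 2) :=
  K.crossingSum ∘ₗ K.colorings.subtype

open Classical in
-- A crossing is even iff its unit vector is a vector of corner sums, and the unit vectors span.
theorem allEven_iff_surjective : K.AllEven ↔ Function.Surjective K.coloringSum := by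
  have : Fintype K.Crossing := Fintype.ofFinite _
  constructor
  · intro h
    rw [← LinearMap.range_eq_top, ← top_le_iff, ← (Pi.basisFun (ZMod 2) K.Crossing).span_eq,
      Submodule.span_le]
    rintro _ ⟨⟨_, p, hp, rfl⟩, rfl⟩
    obtain ⟨h', h⟩ := h p hp
    obtain ⟨c, hc, h⟩ := (K.parity_eq_zero_iff _).1 h
    refine ⟨K.coloringsEquiv hc.onPasted, ?_⟩
    rw [Pi.basisFun_apply, ← h]
    ext z
    refine Finset.sum_congr rfl fun d _ => ?_
    exact K.colorPasted_val _ d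
  · intro h p hp
    refine ⟨⟨p, hp, rfl⟩, (K.parity_eq_zero_iff _).2 ?_⟩
    obtain ⟨c, hc⟩ := h (Pi.single ⟨p.crossing, p, hp, rfl⟩ 1)
    exact ⟨c, (K.mem_colorings.1 c.2).1, hc⟩

/-- The constant colouring 1 has sum 4 = 0 at every crossing, so the kernel of the surjection
`coloringSum` is nonzero. -/
theorem card_crossing_lt_of_allEven (hK : K.core ≠ Cycle.nil) (h : K.AllEven) :
    Nat.card K.Crossing < Nat.card K.PastedCycle := by
  have : Fintype K.Crossing := Fintype.ofFinite _
  have h1 := LinearMap.finrank_range_add_finrank_ker K.coloringSum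
  rw [LinearMap.range_eq_top.2 (K.allEven_iff_surjective.1 h), finrank_top,
    Module.finrank_fintype_fun_eq_card, ← Nat.card_eq_fintype_card, finrank_colorings] at h1
  suffices 0 < Module.finrank (ZMod 2) (LinearMap.ker K.coloringSum) by omega
  obtain ⟨p, hp⟩ : ∃ p, p ∈ K.core := by
    obtain ⟨w, hw⟩ := Quot.exists_rep K.core
    have hw : K.core = w := hw.symm
    cases w with
    | nil => exact absurd hw hK
    | cons p w => exact ⟨p, by rw [hw]; simp⟩
  have hker : K.coloringsEquiv (fun _ => 1) ∈ LinearMap.ker K.coloringSum := by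
    rw [LinearMap.mem_ker]
    ext ⟨_, q, hq, rfl⟩
    refine (K.crossingSum_toCrossing _ ⟨q, hq⟩).trans ?_
    have hq' := K.opposite_mem q hq
    have h1 : ∀ q ∈ K.core, ∀ b, K.colorPasted (fun _ => 1) (q, b) = 1 := fun q hq b => dif_pos hq
    change vertexSum (K.colorPasted fun _ => 1) q = 0
    rw [vertexSum, h1 _ hq, h1 _ hq, h1 _ hq', h1 _ hq']
    decide
  refine Module.finrank_pos_iff_exists_ne_zero.2 ⟨⟨_, hker⟩, fun h0 => ?_⟩
  have := congrArg (fun c => c.1.1 (p, true)) h0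
  simp [coloringsEquiv, colorPasted, hp] at this

end GaussDiagram

theorem ChordEnd.turn_turn {X : Type*} (q : ChordEnd X) (b : Bool) :
    ChordEnd.turn (ChordEnd.turn (q, b)) = (q, !b) := by
  obtain ⟨x, o, s⟩ := q
  rcases Int.units_eq_one_or s with rfl | rfl <;> cases o <;> simp [turn, opposite]

section

variable {X : Type*} {c : ChordEnd X × Bool → ZMod 2}

/-- Each edge at a passage sees two of the four corners, the leaving edge the two which the arriving
edge does not see. -/
theorem leave_sum_eq_arrive_sum {q : ChordEnd X} (h : vertexSum c q = 0) :
    (leave c q).1 + (leave c q).2 = (arrive c q).1 + (arrive c q).2 := by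
  obtain ⟨x, o, s⟩ := q
  rcases Int.units_eq_one_or s with rfl | rfl <;> cases o <;>
  · simp [leave, arrive, vertexSum, ChordEnd.turn, ChordEnd.opposite] at h ⊢
    grind

/-- The sum of the left and right colours is carried unchanged from edge to edge; once it vanishes,
both sides of every half-edge have the same colour. -/
theorem Transit.eq_turn {w : List (ChordEnd X)} (hs : ∀ q ∈ w, vertexSum c q = 0)
    {s t : EdgeState} (h : Transit c w s t) (h0 : s.1 + s.2 = 0) :
    ∀ q ∈ w, ∀ b, c (ChordEnd.turn (q, b)) = c (q, b) := by
  induction w generalizing s with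
  | nil => simp
  | cons p w ih =>
    obtain ⟨rfl, h⟩ := h
    have h1 := leave_sum_eq_arrive_sum (hs p (by simp))
    rw [h0] at h1
    intro q hq b
    rcases List.mem_cons.1 hq with rfl | hq
    · simp only [leave, arrive] at h0 h1
      cases b <;> grind
    · exact ih (fun q hq => hs q (by simp [hq])) h h1 q hq b

theorem Transit.eq_zero {w : List (ChordEnd X)}
    (hs : ∀ q ∈ w, ∀ b, c (ChordEnd.turn (q, b)) = c (q, b) ∧ c (q, !b) = c (q, b))
    {s t : EdgeState} (h : Transit c w s t) (h0 : s = 0) : ∀ q ∈ w, ∀ b, c (q, b) = 0 := by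
  induction w generalizing s with
  | nil => simp
  | cons p w ih =>
    obtain ⟨rfl, h⟩ := h
    have h1 : c (p, false) = 0 := congrArg Prod.fst h0
    have h2 : c (p, true) = 0 := by rw [← h1]; exact (hs p (by simp) false).2
    intro q hq b
    rcases List.mem_cons.1 hq with rfl | hq
    · cases b <;> assumption
    · refine ih (fun q hq => hs q (by simp [hq])) h ?_ q hq b
      rw [leave, (hs p (by simp) true).1, h2]
      rfl

end

namespace GaussDiagram

variable {X Y : Type*} (K : GaussDiagram X)

/-- If one edge has colour 0 on both sides, every edge has equal colours on its two sides; then the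
colour is constant around each crossing, and following the knot carries the value 0 everywhere. -/
theorem eq_zero_of_vertexSum_eq_zero {c : ChordEnd X × Bool → ZMod 2} (hc : c ∈ K.colorings)
    (hs : ∀ p ∈ K.core, vertexSum c p = 0) {p : ChordEnd X} {w : List (ChordEnd X)}
    (hw : K.core = ↑(p :: w)) (h0 : arrive c p = 0) : c = 0 := by
  obtain ⟨hc, hz⟩ := K.mem_colorings.1 hc
  rw [IsColoring, hw, chain_iff_transit] at hc
  obtain ⟨s, ht⟩ := hc
  have h0 : s = 0 := ht.1.symm.trans h0
  have hs' : ∀ q ∈ p :: w, vertexSum c q = 0 := fun q hq => hs q (by rw [hw]; exact hq)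
  have h1 := ht.eq_turn hs' (by rw [h0]; rfl)
  have h2 : ∀ q ∈ p :: w, ∀ b, c (ChordEnd.turn (q, b)) = c (q, b) ∧ c (q, !b) = c (q, b) := by
    intro q hq b
    refine ⟨h1 q hq b, ?_⟩
    -- Passing straight through the crossing is two quarter turns, the second one made at the
    -- opposite passage, which also lies in the word.
    rw [← ChordEnd.turn_turn, ← h1 q hq b]
    refine h1 _ ?_ _
    have := K.opposite_mem q (by rw [hw]; exact hq)
    rwa [hw] at this
  have h3 := ht.eq_zero h2 h0
  ext ⟨q, b⟩
  by_cases hq : q ∈ K.core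
  · exact h3 q (by rwa [hw] at hq) b
  · exact hz _ hq

/-- The kernel of `coloringSum` embeds into the states of one edge, so it has dimension at most 2
and the rank is at least the number of crossings. -/
theorem allEven_of_card_le (h : Nat.card K.Crossing + 2 ≤ Nat.card K.PastedCycle) :
    K.AllEven := by
  have : Fintype K.Crossing := Fintype.ofFinite _
  obtain ⟨w, hw⟩ := Quot.exists_rep K.core
  have hw : K.core = w := hw.symm
  cases w with
  | nil => intro p hp; rw [hw] at hp; simp at hp
  | cons p w =>
  rw [allEven_iff_surjective, ← LinearMap.range_eq_top]
  have h1 := LinearMap.finrank_range_add_finrank_ker K.coloringSum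
  rw [finrank_colorings] at h1
  let φ : LinearMap.ker K.coloringSum →ₗ[ZMod 2] ZMod 2 × ZMod 2 :=
    { toFun := fun c => arrive c.1.1 p
      map_add' := fun _ _ => rfl
      map_smul' := fun _ _ => rfl }
  have hφ : Function.Injective φ := by
    refine (injective_iff_map_eq_zero φ).2 fun c hc => Subtype.ext (Subtype.ext ?_)
    refine K.eq_zero_of_vertexSum_eq_zero c.1.2 (fun q hq => ?_) hw hc
    rw [← K.crossingSum_toCrossing _ ⟨q, hq⟩]
    exact congrFun (LinearMap.mem_ker.1 c.2) _
  have h2 := LinearMap.finrank_le_finrank_of_injective hφ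
  rw [Module.finrank_prod, Module.finrank_self] at h2
  refine Submodule.eq_top_of_finrank_eq (le_antisymm (Submodule.finrank_le _) ?_)
  rw [Module.finrank_fintype_fun_eq_card, ← Nat.card_eq_fintype_card]
  omega

/-- Colourings pull back along the renaming, injectively because every end of `K'` is the image of
an end of `K`; their dimensions count the pasted cycles. -/
theorem card_pastedCycle_le_of_relabel {K' : GaussDiagram Y} {f : X → Y}
    (h : K.core.map (ChordEnd.relabel f) = K'.core) :
    Nat.card K'.PastedCycle ≤ Nat.card K.PastedCycle := by
  classical
  rw [← finrank_colorings, ← finrank_colorings]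
  have hmem : ∀ q ∈ K'.core, ∃ p ∈ K.core, ChordEnd.relabel f p = q := by
    intro q hq
    rw [← h] at hq
    simpa [eq_comm] using hq
  let g : (ChordEnd Y × Bool → ZMod 2) → ChordEnd X × Bool → ZMod 2 :=
    fun c d => if d.1 ∈ K.core then c (d.1.relabel f, d.2) else 0
  have hg : ∀ c, K'.IsColoring c → K.IsColoring (g c) := by
    intro c hc
    rw [IsColoring, ← h, Cycle.chain_map] at hc
    have h1 := (K.isColoring_iff_succ (fun d => c (d.1.relabel f, d.2))).1 hc
    rw [isColoring_iff_succ]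
    have h2 : ∀ p ∈ K.core, ∀ b, g c (p, b) = c (p.relabel f, b) := fun p hp b => if_pos hp
    intro p
    have h3 := K.opposite_mem p.1 p.2
    have h4 := K.opposite_mem _ (K.succ p).2
    have h5 := h1 p
    simp only [leave, arrive, ChordEnd.turn] at h5 ⊢
    rw [h2 _ p.2, h2 _ (K.succ p).2, h2 _ h3, h2 _ h4]
    exact h5
  let φ : K'.colorings →ₗ[ZMod 2] K.colorings :=
    { toFun := fun c => ⟨g c.1, K.mem_colorings.2
        ⟨hg c.1 (K'.mem_colorings.1 c.2).1, fun d hd => if_neg hd⟩⟩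
      map_add' := fun c c' => by
        ext d
        simp only [g, Submodule.coe_add, Pi.add_apply]
        split_ifs <;> simp
      map_smul' := fun a c => by
        ext d
        simp only [g, Submodule.coe_smul, Pi.smul_apply, RingHom.id_apply]
        split_ifs <;> simp }
  refine LinearMap.finrank_le_finrank_of_injective (f := φ) ?_
  refine (injective_iff_map_eq_zero φ).2 fun c hc => Subtype.ext ?_
  ext ⟨q, b⟩
  by_cases hq : q ∈ K'.core
  · obtain ⟨p, hp, rfl⟩ := hmem q hq
    have := congrArg (fun c => c.1 (p, b)) hc
    simpa [φ, g, hp] using this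
  · exact (K'.mem_colorings.1 c.2).2 _ hq

theorem VirtuallyEquivalent.length_eq {K : GaussDiagram X} {K' : GaussDiagram Y}
    (h : K.VirtuallyEquivalent K') : K.core.length = K'.core.length := by
  obtain ⟨f, h⟩ := h
  obtain ⟨w, hw⟩ := Quot.exists_rep K.core
  have hw : K.core = w := hw.symm
  rw [← h, hw]
  simp

/-- The Euler characteristic is positive, and `2 - 2 * g` is positive only for `g = 0`; so `K`
itself is the required diagram. -/
theorem isClassical_of_allEven {g : ℕ} (hK : K.HasGenus g) (h : K.AllEven) : K.IsClassical := by
  refine ⟨K, ?_, K.virtuallyEquivalent_refl⟩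
  by_cases hn : K.core = Cycle.nil
  · simp [HasGenus, eulerChar, hn]
  · have h1 := K.card_crossing_lt_of_allEven hn h
    unfold HasGenus at *
    rw [K.eulerChar_of_ne_nil hn] at *
    omega

/-- The planar diagram has two more pasted cycles than crossings. `K` has as many crossings and at
least as many pasted cycles. -/
theorem allEven_of_isClassical (h : K.IsClassical) : K.AllEven := by
  obtain ⟨K', hg, f, h⟩ := h
  by_cases hn : K.core = Cycle.nil
  · intro p hp
    simp [hn] at hp
  have hn' : K'.core ≠ Cycle.nil := by
    rw [← h]
    simpa using hn
  refine K.allEven_of_card_le ?_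
  have h1 := K.card_pastedCycle_le_of_relabel h
  have h2 := VirtuallyEquivalent.length_eq ⟨f, h⟩
  rw [length_core, length_core] at h2
  rw [HasGenus, K'.eulerChar_of_ne_nil hn'] at hg
  omega

theorem l_virtuallyEquivalent_iff {g : ℕ} (hK : K.HasGenus g) :
    K.l.VirtuallyEquivalent K ↔ K.IsClassical := by
  constructor
  · exact fun h => K.isClassical_of_allEven hK (K.allEven_of_length_le h.length_eq.ge)
  · intro h
    rw [(K.allEven_of_isClassical h).l_eq]
    exact K.virtuallyEquivalent_refl

end GaussDiagram

/-! ### Uniqueness of states and independence of colours elsewhere. -/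

section

variable {X : Type*} {c c' : ChordEnd X × Bool → ZMod 2}

theorem Transit.unique {w : List (ChordEnd X)} (hw : w ≠ []) {s t s' t' : EdgeState}
    (h : Transit c w s t) (h' : Transit c w s' t') : s = s' ∧ t = t' := by
  induction w generalizing s s' with
  | nil => exact absurd rfl hw
  | cons p w ih =>
    obtain ⟨rfl, h⟩ := h
    obtain ⟨rfl, h'⟩ := h'
    refine ⟨rfl, ?_⟩
    cases w with
    | nil => exact h.symm.trans h'
    | cons q w => exact (ih (by simp) h h').2

theorem Transit.unique_closed {w₁ w₂ : List (ChordEnd X)} (hw : w₁ ++ w₂ ≠ [])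
    {s t s' t' : EdgeState} (h₁ : Transit c w₁ s t) (h₂ : Transit c w₂ t s)
    (h₁' : Transit c w₁ s' t') (h₂' : Transit c w₂ t' s') : s = s' ∧ t = t' := by
  by_cases h : w₁ = []
  · subst h
    obtain rfl : s = t := h₁
    obtain rfl : s' = t' := h₁'
    exact h₂.unique (by simpa using hw) h₂'
  · exact h₁.unique h h₁'

theorem transit_congr_off {S : X → Prop}
    (h : ∀ d : ChordEnd X × Bool, ¬ S d.1.crossing → c d = c' d)
    {w : List (ChordEnd X)} (hw : ∀ p ∈ w, ¬ S p.crossing) {s t : EdgeState} :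
    Transit c w s t ↔ Transit c' w s t :=
  transit_congr fun p hp _ => ⟨h _ (hw p hp), h _ (hw p hp)⟩

theorem vertexSum_congr_off {S : X → Prop}
    (h : ∀ d : ChordEnd X × Bool, ¬ S d.1.crossing → c d = c' d)
    {p : ChordEnd X} (hp : ¬ S p.crossing) : vertexSum c p = vertexSum c' p :=
  vertexSum_congr fun _ => ⟨h _ hp, h _ hp⟩

theorem mem_orderedPair {α : Type*} {o : ℤˣ} {p q a : α} :
    a ∈ orderedPair o p q ↔ a = p ∨ a = q := by
  unfold orderedPair
  split_ifs <;> simp [or_comm]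

theorem orderedPair_perm {α : Type*} (o : ℤˣ) (p q : α) : (orderedPair o p q).Perm [p, q] := by
  unfold orderedPair
  split_ifs
  · exact List.Perm.refl _
  · exact List.Perm.swap _ _ _

theorem filter_orderedPair {α : Type*} (P : α → Bool) (o : ℤˣ) {p q : α} (hp : P p) (hq : P q) :
    (orderedPair o p q).filter P = orderedPair o p q := by
  unfold orderedPair
  split_ifs <;> simp [hp, hq]

/-- When at most one letter survives, the order of the two is lost. -/
theorem filter_orderedPair_eq {α : Type*} (P : α → Bool) (o o' : ℤˣ) {p q : α}
    (h : ¬ (P p ∧ P q)) : (orderedPair o p q).filter P = (orderedPair o' p q).filter P := by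
  unfold orderedPair
  cases hp : P p <;> cases hq : P q <;> split_ifs <;> simp_all

end

/-! ### Even crossings and the first move. -/

namespace GaussDiagram

variable {X : Type*} {K K₁ : GaussDiagram X}

/-- A chord has only one end of each kind, and `u` contains both already. -/
theorem crossing_ne_of_mem_of_perm {w u r : List (ChordEnd X)} {x : X} {o : Bool} {s s' : ℤˣ}
    (hK : K.core = w) (hw : w.Perm (u ++ r)) (h : ⟨x, o, s⟩ ∈ u) (h' : ⟨x, !o, s'⟩ ∈ u) :
    ∀ p ∈ r, p.crossing ≠ x := by
  have hn := K.nodup_ends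
  rw [hK] at hn
  have hn : (w.map fun p => (p.crossing, p.isOver)).Nodup := hn
  have hn := (hw.map _).nodup hn
  rw [List.map_append, List.nodup_append] at hn
  rintro p hp rfl
  by_cases h₀ : p.isOver = o
  · exact hn.2.2 _ (List.mem_map_of_mem h) _ (List.mem_map_of_mem hp) (by rw [h₀])
  · refine hn.2.2 _ (List.mem_map_of_mem h') _ (List.mem_map_of_mem hp) ?_
    rw [Bool.eq_not_of_ne h₀]

theorem crossing_ne_of_perm {w r : List (ChordEnd X)} {x : X} {o : Bool} {s : ℤˣ}
    (hK : K.core = w) (hw : w.Perm (⟨x, o, s⟩ :: ⟨x, !o, s⟩ :: r)) : ∀ p ∈ r, p.crossing ≠ x :=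
  crossing_ne_of_mem_of_perm (u := [⟨x, o, s⟩, ⟨x, !o, s⟩]) (o := o) (s := s) (s' := s) hK hw
    (by simp) (by simp)

theorem IsColoring.add {c c' : ChordEnd X × Bool → ZMod 2} (h : K.IsColoring c)
    (h' : K.IsColoring c') : K.IsColoring (c + c') := by
  rw [isColoring_iff_step] at *
  intro d
  simp [h d, h' d]

theorem isColoring_iff_transit {w : List (ChordEnd X)} (hK : K.core = w)
    {c : ChordEnd X × Bool → ZMod 2} : K.IsColoring c ↔ ∃ s, Transit c w s s := by
  rw [IsColoring, hK, chain_iff_transit]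

/-- The sums of the colours at the crossings are those which express that `x` is even. -/
def Shows (c : ChordEnd X × Bool → ZMod 2) (x : X) (w : List (ChordEnd X)) : Prop :=
  ∀ p ∈ w, (p.crossing = x → vertexSum c p = 1) ∧ (p.crossing ≠ x → vertexSum c p = 0)

theorem isEven_iff_shows {w : List (ChordEnd X)} (hK : K.core = w) (x : X) :
    K.IsEven x ↔ (∃ p ∈ w, p.crossing = x) ∧ ∃ c, K.IsColoring c ∧ Shows c x w := by
  rw [isEven_iff, hK]
  refine and_congr Iff.rfl (exists_congr fun c => and_congr_right fun _ => ?_)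
  refine forall₂_congr fun p _ => ?_
  by_cases h : p.crossing = x <;> simp [h]

theorem shows_append {c : ChordEnd X × Bool → ZMod 2} {x : X} {u v : List (ChordEnd X)} :
    Shows c x (u ++ v) ↔ Shows c x u ∧ Shows c x v :=
  List.forall_mem_append

theorem shows_congr_off {c c' : ChordEnd X × Bool → ZMod 2} {S : X → Prop}
    (h : ∀ d : ChordEnd X × Bool, ¬ S d.1.crossing → c d = c' d)
    {w : List (ChordEnd X)} (hw : ∀ p ∈ w, ¬ S p.crossing) {x : X} :
    Shows c x w ↔ Shows c' x w :=
  forall₂_congr fun p hp => by rw [vertexSum_congr_off h (hw p hp)]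

section First

variable {x : X} {o : Bool} {s : ℤˣ} {w : List (ChordEnd X)}

theorem isEven_first (hK₁ : K₁.core = ([⟨x, o, s⟩, ⟨x, !o, s⟩] ++ w : List (ChordEnd X))) :
    K₁.IsEven x := by
  have hx : ∀ p ∈ w, p.crossing ≠ x := crossing_ne_of_perm hK₁ (List.Perm.refl _)
  obtain ⟨v, h, hv⟩ := exists_recolor_first x o s 0 0 1
  have hoff : ∀ d : ChordEnd X × Bool, ¬ d.1.crossing = x → recolor x v 0 d = 0 :=
    fun d hd => recolor_of_ne _ _ hd
  rw [isEven_iff_shows hK₁]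
  refine ⟨⟨⟨x, o, s⟩, by simp, rfl⟩, recolor x v 0, ?_, ?_⟩
  · rw [isColoring_iff_transit hK₁]
    exact ⟨0, (transit_append _ _ _ _ _).2 ⟨0, h,
      (transit_congr_off (S := fun z => z = x) hoff hx).2 (transit_zero w)⟩⟩
  · intro p hp
    simp only [List.cons_append, List.nil_append, List.mem_cons] at hp
    rcases hp with rfl | rfl | hp
    · exact ⟨fun _ => hv, fun h => absurd rfl h⟩
    · exact ⟨fun _ => (vertexSum_opposite _ _).trans hv, fun h => absurd rfl h⟩
    · refine ⟨fun h => absurd h (hx p hp), fun _ => ?_⟩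
      rw [vertexSum_congr_off (S := fun z => z = x) hoff (hx p hp)]
      rfl

/-- Removing the kink leaves the states of its two outer edges equal; conversely the monogon is
coloured so that the new crossing has sum 0. -/
theorem isEven_first_iff (hK : K.core = w)
    (hK₁ : K₁.core = ([⟨x, o, s⟩, ⟨x, !o, s⟩] ++ w : List (ChordEnd X))) {y : X} (hy : y ≠ x) :
    K₁.IsEven y ↔ K.IsEven y := by
  have hx : ∀ p ∈ w, p.crossing ≠ x := crossing_ne_of_perm hK₁ (List.Perm.refl _)
  rw [isEven_iff_shows hK₁, isEven_iff_shows hK]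
  refine and_congr (by simp [hy.symm]) ?_
  simp only [isColoring_iff_transit hK₁, isColoring_iff_transit hK, transit_append, shows_append]
  constructor
  · rintro ⟨c, ⟨e, e', h, h'⟩, hs, hs'⟩
    have := transit_first x o s c e e' h ((hs _ (by simp)).2 hy.symm)
    subst this
    exact ⟨c, ⟨e, h'⟩, hs'⟩
  · rintro ⟨c, ⟨e, h⟩, hs⟩
    obtain ⟨v, h', hv⟩ := exists_recolor_first x o s c e 0
    have hoff : ∀ d : ChordEnd X × Bool, ¬ d.1.crossing = x → recolor x v c d = c d :=
      fun d hd => recolor_of_ne _ _ hd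
    refine ⟨recolor x v c, ⟨e, e, h', (transit_congr_off (S := fun z => z = x) hoff hx).2 h⟩, ?_,
      (shows_congr_off (S := fun z => z = x) hoff hx).2 hs⟩
    intro p hp
    simp only [List.mem_cons, List.not_mem_nil, or_false] at hp
    rcases hp with rfl | rfl
    · exact ⟨fun h => absurd h.symm hy, fun _ => hv⟩
    · exact ⟨fun h => absurd h.symm hy, fun _ => (vertexSum_opposite _ _).trans hv⟩

end First

theorem l_takes_first {x : X} (h : (ReidemeisterMove.first x).Takes K K₁) :
    (ReidemeisterMove.first x).Takes K.l K₁.l := by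
  classical
  obtain ⟨o, s, w, hK, hK₁⟩ := h
  have hx : ∀ p ∈ w, p.crossing ≠ x := crossing_ne_of_perm hK₁ (List.Perm.refl _)
  refine ⟨o, s, w.filter fun p => decide (K.IsEven p.crossing), K.l_core_eq hK, ?_⟩
  rw [K₁.l_core_eq hK₁, List.filter_append]
  congr 2
  · simp [isEven_first hK₁]
  · refine List.filter_congr fun p hp => ?_
    rw [isEven_first_iff hK hK₁ (hx p hp)]

/-! ### The second move. -/

section Second

variable {x y : X} {s o o' : ℤˣ} {w₁ w₂ : List (ChordEnd X)}

/-- The word of a diagram after the second move. -/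
def secondWord (x y : X) (s o o' : ℤˣ) (w₁ w₂ : List (ChordEnd X)) : List (ChordEnd X) :=
  orderedPair o ⟨x, true, s⟩ ⟨y, true, -s⟩ ++ w₁ ++
    orderedPair o' ⟨x, false, s⟩ ⟨y, false, -s⟩ ++ w₂

theorem secondWord_perm_left : (secondWord x y s o o' w₁ w₂).Perm
    (⟨x, true, s⟩ :: ⟨x, !true, s⟩ :: ⟨y, true, -s⟩ :: ⟨y, false, -s⟩ :: (w₁ ++ w₂)) := by
  classical
  rw [List.perm_iff_count]
  intro a
  have h₁ := (orderedPair_perm o (⟨x, true, s⟩ : ChordEnd X) ⟨y, true, -s⟩).count_eq a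
  have h₂ := (orderedPair_perm o' (⟨x, false, s⟩ : ChordEnd X) ⟨y, false, -s⟩).count_eq a
  simp only [secondWord, List.count_append, List.count_cons, List.count_nil, Bool.not_true] at *
  omega

theorem secondWord_crossing_ne (hK₁ : K₁.core = secondWord x y s o o' w₁ w₂) :
    ∀ p ∈ w₁ ++ w₂, ¬ (p.crossing = x ∨ p.crossing = y) := by
  have hx := crossing_ne_of_perm hK₁ secondWord_perm_left
  have hy := crossing_ne_of_perm (x := y) (o := true) (s := -s)
    (r := ⟨x, true, s⟩ :: ⟨x, false, s⟩ :: (w₁ ++ w₂)) hK₁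
    (secondWord_perm_left.trans
      ((List.perm_append_comm (l₁ := [_, _]) (l₂ := [_, _])).append_right _))
  intro p hp
  have := hx p (by simp only [List.mem_cons]; tauto)
  have := hy p (by simp only [List.mem_cons]; tauto)
  tauto

theorem mem_secondWord {p : ChordEnd X} : p ∈ secondWord x y s o o' w₁ w₂ ↔
    (p = ⟨x, true, s⟩ ∨ p = ⟨x, false, s⟩ ∨ p = ⟨y, true, -s⟩ ∨ p = ⟨y, false, -s⟩) ∨
      p ∈ w₁ ++ w₂ := by
  rw [secondWord_perm_left.mem_iff]
  simp only [List.mem_cons, Bool.not_true]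
  tauto

theorem transit_secondWord {c : ChordEnd X × Bool → ZMod 2} {e f : EdgeState} :
    Transit c (secondWord x y s o o' w₁ w₂) e f ↔ ∃ e₁ e' e₁',
      Transit c (orderedPair o ⟨x, true, s⟩ ⟨y, true, -s⟩) e e₁ ∧ Transit c w₁ e₁ e' ∧
      Transit c (orderedPair o' ⟨x, false, s⟩ ⟨y, false, -s⟩) e' e₁' ∧ Transit c w₂ e₁' f := by
  simp only [secondWord, transit_append]
  constructor
  · rintro ⟨_, ⟨_, ⟨_, h₁, h₂⟩, h₃⟩, h₄⟩
    exact ⟨_, _, _, h₁, h₂, h₃, h₄⟩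
  · rintro ⟨_, _, _, h₁, h₂, h₃, h₄⟩
    exact ⟨_, ⟨_, ⟨_, h₁, h₂⟩, h₃⟩, h₄⟩

theorem recolor_recolor_off (v v' : Bool → Bool → ZMod 2) (c : ChordEnd X × Bool → ZMod 2)
    (d : ChordEnd X × Bool) (hd : ¬ (d.1.crossing = x ∨ d.1.crossing = y)) :
    recolor x v (recolor y v' c) d = c d := by
  rw [not_or] at hd
  rw [recolor_of_ne _ _ hd.1, recolor_of_ne _ _ hd.2]

/-- The colouring of the bigon. -/
theorem exists_bigon (hxy : x ≠ y) (hK₁ : K₁.core = secondWord x y s o o' w₁ w₂) :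
    ∃ c, K₁.IsColoring c ∧ ∀ p ∈ K₁.core, ((p.crossing = x ∨ p.crossing = y) → vertexSum c p = 1) ∧
      (¬ (p.crossing = x ∨ p.crossing = y) → vertexSum c p = 0) := by
  have hne := secondWord_crossing_ne hK₁
  obtain ⟨v, v', h₁, h₂, hx, hy⟩ :=
    exists_recolor_second hxy o o' s 0 0 0 1 (by simp [EdgeState.side])
  have hoff := recolor_recolor_off (x := x) (y := y) v v' 0
  generalize recolor x v (recolor y v' 0) = c at *
  simp only [List.mem_append] at hne
  refine ⟨c, (isColoring_iff_transit hK₁).2 ⟨0, transit_secondWord.2 ⟨0, 0, 0, h₁, ?_, h₂, ?_⟩⟩, ?_⟩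
  · exact (transit_congr_off (S := fun z => z = x ∨ z = y) hoff
      fun p hp => hne p (.inl hp)).2 (transit_zero _)
  · exact (transit_congr_off (S := fun z => z = x ∨ z = y) hoff
      fun p hp => hne p (.inr hp)).2 (transit_zero _)
  · intro p hp
    refine ⟨fun h => ?_, fun h => ?_⟩
    · rw [hK₁] at hp
      rcases mem_secondWord.1 hp with (rfl | rfl | rfl | rfl) | hp
      · exact hx
      · exact (vertexSum_opposite c ⟨x, true, s⟩).trans hx
      · exact hy
      · exact (vertexSum_opposite c ⟨y, true, -s⟩).trans hy
      · exact absurd h (hne p (List.mem_append.1 hp))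
    · rw [vertexSum_congr_off (S := fun z => z = x ∨ z = y) hoff h]
      rfl

/-- Adding the colouring of the bigon moves the sum 1 from one crossing to the other. -/
theorem isEven_second_comm (hxy : x ≠ y) (hK₁ : K₁.core = secondWord x y s o o' w₁ w₂) :
    K₁.IsEven x ↔ K₁.IsEven y := by
  obtain ⟨b, hb, hb'⟩ := exists_bigon hxy hK₁
  rw [hK₁] at hb'
  rw [isEven_iff_shows hK₁, isEven_iff_shows hK₁]
  refine and_congr (iff_of_true ⟨_, mem_secondWord.2 (.inl (.inl rfl)), rfl⟩
    ⟨_, mem_secondWord.2 (.inl (.inr (.inr (.inl rfl)))), rfl⟩) ?_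
  constructor
  · rintro ⟨c, hc, h⟩
    refine ⟨c + b, hc.add hb, fun p hp => ?_⟩
    have := h p hp
    have := hb' p hp
    rw [vertexSum_add]
    by_cases hx : p.crossing = x <;> by_cases hy : p.crossing = y <;> grind
  · rintro ⟨c, hc, h⟩
    refine ⟨c + b, hc.add hb, fun p hp => ?_⟩
    have := h p hp
    have := hb' p hp
    rw [vertexSum_add]
    by_cases hx : p.crossing = x <;> by_cases hy : p.crossing = y <;> grind

end Second

end GaussDiagram

namespace GaussDiagram

variable {X : Type*} {K K₁ : GaussDiagram X}

theorem IsColoring.exists_mem_colorings {c : ChordEnd X × Bool → ZMod 2} (hc : K.IsColoring c) :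
    ∃ c' ∈ K.colorings, ∀ d : ChordEnd X × Bool, d.1 ∈ K.core → c' d = c d :=
  ⟨_, (K.coloringsEquiv hc.onPasted).2, fun d hd => K.colorPasted_val _ (⟨d.1, hd⟩, d.2)⟩

section Second

variable {x y : X} {s o o' : ℤˣ} {w₁ w₂ : List (ChordEnd X)}

theorem transit_of_secondWord {c : ChordEnd X × Bool → ZMod 2}
    (hK₁ : K₁.core = secondWord x y s o o' w₁ w₂) (hc : K₁.IsColoring c)
    (h : vertexSum c ⟨x, true, s⟩ = vertexSum c ⟨y, true, -s⟩) :
    ∃ e e', Transit c (orderedPair o ⟨x, true, s⟩ ⟨y, true, -s⟩) e e ∧ Transit c w₁ e e' ∧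
      Transit c (orderedPair o' ⟨x, false, s⟩ ⟨y, false, -s⟩) e' e' ∧ Transit c w₂ e' e ∧
      e.side (s * o') = e'.side (-(s * o)) := by
  obtain ⟨e, he⟩ := (isColoring_iff_transit hK₁).1 hc
  obtain ⟨e₁, e', e₁', h₁, h₂, h₃, h₄⟩ := transit_secondWord.1 he
  obtain ⟨rfl, rfl, h'⟩ := transit_second o o' s c _ _ _ _ h₁ h₃ h
  exact ⟨_, _, h₁, h₂, h₃, h₄, h'⟩

open Classical in
/-- The part of a colouring on the diagram before a move. -/
noncomputable def restrict (K : GaussDiagram X) :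
    (ChordEnd X × Bool → ZMod 2) →ₗ[ZMod 2] (ChordEnd X × Bool → ZMod 2) where
  toFun c d := if d.1 ∈ K.core then c d else 0
  map_add' c c' := by ext d; simp only [Pi.add_apply]; split_ifs <;> simp
  map_smul' a c := by ext d; simp only [Pi.smul_apply, RingHom.id_apply]; split_ifs <;> simp

theorem transit_restrict {w : List (ChordEnd X)} (hw : ∀ p ∈ w, p ∈ K.core)
    (c : ChordEnd X × Bool → ZMod 2) {e f : EdgeState} :
    Transit (K.restrict c) w e f ↔ Transit c w e f :=
  transit_congr fun p hp _ => ⟨if_pos (hw p hp), if_pos (K.opposite_mem p (hw p hp))⟩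

/-- Equal Euler characteristics mean two more pasted cycles after the move. Hence colourings of `K₁`
with sums 0 at `x` and `y` form a space of dimension at least that of the colourings of `K`, into
which it embeds by restriction. All restrictions satisfy the condition on the facing sides, so a
colouring of `K` violating it would make the image too small. -/
theorem side_eq_of_eulerChar_eq (hK : K.core = (w₁ ++ w₂ : List (ChordEnd X)))
    (hK₁ : K₁.core = secondWord x y s o o' w₁ w₂) (hw : w₁ ++ w₂ ≠ [])
    (hχ : K.eulerChar = K₁.eulerChar) {c₀ : ChordEnd X × Bool → ZMod 2} {e e' : EdgeState}
    (h₁ : Transit c₀ w₁ e e') (h₂ : Transit c₀ w₂ e' e) :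
    e.side (s * o') = e'.side (-(s * o)) := by
  by_contra hside
  have hw₁ : ∀ p ∈ w₁, p ∈ K.core := fun p hp => by rw [hK]; simp [hp]
  have hw₂ : ∀ p ∈ w₂, p ∈ K.core := fun p hp => by rw [hK]; simp [hp]
  have hcol₀ : K.IsColoring c₀ :=
    (isColoring_iff_transit hK).2 ⟨e, (transit_append _ _ _ _ _).2 ⟨e', h₁, h₂⟩⟩
  obtain ⟨c₁, hc₁, heq⟩ := hcol₀.exists_mem_colorings
  have h₁ : Transit c₁ w₁ e e' := (transit_congr fun p hp b =>
    ⟨heq (p, b) (hw₁ p hp), heq (_, b) (K.opposite_mem p (hw₁ p hp))⟩).2 h₁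
  have h₂ : Transit c₁ w₂ e' e := (transit_congr fun p hp b =>
    ⟨heq (p, b) (hw₂ p hp), heq (_, b) (K.opposite_mem p (hw₂ p hp))⟩).2 h₂
  let Ψ : K₁.colorings →ₗ[ZMod 2] ZMod 2 × ZMod 2 :=
    { toFun := fun c => (vertexSum c.1 ⟨x, true, s⟩, vertexSum c.1 ⟨y, true, -s⟩)
      map_add' := fun c c' => Prod.ext (vertexSum_add _ _ _) (vertexSum_add _ _ _)
      map_smul' := fun a c => by ext <;> simp [vertexSum, mul_add] }
  let ρ : LinearMap.ker Ψ →ₗ[ZMod 2] (ChordEnd X × Bool → ZMod 2) :=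
    K.restrict ∘ₗ K₁.colorings.subtype ∘ₗ (LinearMap.ker Ψ).subtype
  have key : ∀ c : LinearMap.ker Ψ, vertexSum c.1.1 ⟨x, true, s⟩ = 0 ∧
      vertexSum c.1.1 ⟨y, true, -s⟩ = 0 := fun c => Prod.ext_iff.1 (LinearMap.mem_ker.1 c.2)
  have key' := fun c : LinearMap.ker Ψ =>
    transit_of_secondWord hK₁ (K₁.mem_colorings.1 c.1.2).1 ((key c).1.trans (key c).2.symm)
  have hinj : Function.Injective ρ := by
    refine (injective_iff_map_eq_zero ρ).2 fun c hc => Subtype.ext (Subtype.ext ?_)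
    obtain ⟨f, f', k₁, k₂, k₃, k₄, -⟩ := key' c
    have hc : K.restrict c.1.1 = 0 := hc
    have k₂' := (transit_restrict hw₁ c.1.1).2 k₂
    have k₄' := (transit_restrict hw₂ c.1.1).2 k₄
    rw [hc] at k₂' k₄'
    -- Here nonemptiness of the old word is needed: it makes the outer states vanish, and the sums
    -- then force 0 on the bigon as well.
    obtain ⟨rfl, rfl⟩ := Transit.unique_closed hw k₂' k₄' (transit_zero _) (transit_zero _)
    have k₅ := transit_second_zero o o' s c.1.1 k₁ k₃ (key c).1 (key c).2
    ext ⟨p, b⟩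
    by_cases hp : p ∈ K₁.core
    · rw [hK₁] at hp
      rcases mem_secondWord.1 hp with (rfl | rfl | rfl | rfl) | hp
      · exact (k₅ _ b).1
      · exact (k₅ _ b).1
      · exact (k₅ _ b).2
      · exact (k₅ _ b).2
      · exact (if_pos (by rw [hK]; exact hp) : K.restrict c.1.1 (p, b) = _).symm.trans
          (congrFun hc (p, b))
    · exact (K₁.mem_colorings.1 c.1.2).2 _ hp
  have hle : LinearMap.range ρ ≤ K.colorings := by
    rintro _ ⟨c, rfl⟩
    obtain ⟨f, f', k₁, k₂, k₃, k₄, -⟩ := key' c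
    refine K.mem_colorings.2 ⟨?_, fun d hd => if_neg hd⟩
    exact (isColoring_iff_transit hK).2 ⟨f, (transit_append _ _ _ _ _).2
      ⟨f', (transit_restrict hw₁ c.1.1).2 k₂, (transit_restrict hw₂ c.1.1).2 k₄⟩⟩
  -- The truncation `c₁` of the violating colouring cannot be a restriction.
  have hlt : LinearMap.range ρ < K.colorings := by
    refine lt_of_le_of_ne hle fun h => ?_
    rw [← h] at hc₁
    obtain ⟨c, rfl⟩ := hc₁
    obtain ⟨f, f', k₁, k₂, k₃, k₄, k₅⟩ := key' c
    have h₁ := (transit_restrict hw₁ c.1.1).1 h₁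
    have h₂ := (transit_restrict hw₂ c.1.1).1 h₂
    obtain ⟨rfl, rfl⟩ := Transit.unique_closed hw h₁ h₂ k₂ k₄
    exact hside k₅
  have d₁ := Submodule.finrank_lt_finrank_of_lt hlt
  have d₂ := LinearMap.finrank_range_of_inj hinj
  have d₃ := LinearMap.finrank_range_add_finrank_ker Ψ
  have d₄ := Submodule.finrank_le (LinearMap.range Ψ)
  rw [Module.finrank_prod, Module.finrank_self] at d₄
  rw [finrank_colorings] at d₁ d₃
  have hn : K.core ≠ Cycle.nil := by rwa [hK, Ne, Cycle.coe_eq_nil]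
  have hn₁ : K₁.core ≠ Cycle.nil := by
    rw [hK₁, Ne, Cycle.coe_eq_nil]
    exact List.ne_nil_of_mem (mem_secondWord.2 (.inl (.inl rfl)))
  rw [K.eulerChar_of_ne_nil hn, K₁.eulerChar_of_ne_nil hn₁] at hχ
  have l := K.length_core
  have l₁ := K₁.length_core
  rw [hK, Cycle.length_coe] at l
  rw [hK₁, Cycle.length_coe, secondWord_perm_left.length_eq] at l₁
  simp only [List.length_cons] at l₁
  omega

theorem isEven_second_iff (hxy : x ≠ y) (hK : K.core = (w₁ ++ w₂ : List (ChordEnd X)))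
    (hK₁ : K₁.core = secondWord x y s o o' w₁ w₂) (hχ : K.eulerChar = K₁.eulerChar) {z : X}
    (hz : ¬ (z = x ∨ z = y)) : K₁.IsEven z ↔ K.IsEven z := by
  have hne := secondWord_crossing_ne hK₁
  have hocc : (∃ p ∈ secondWord x y s o o' w₁ w₂, p.crossing = z) ↔
      ∃ p ∈ w₁ ++ w₂, p.crossing = z := by
    constructor
    · rintro ⟨p, hp, rfl⟩
      rcases mem_secondWord.1 hp with (rfl | rfl | rfl | rfl) | hp
      · simp at hz
      · simp at hz
      · simp at hz
      · simp at hz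
      · exact ⟨p, hp, rfl⟩
    · rintro ⟨p, hp, h⟩
      exact ⟨p, mem_secondWord.2 (.inr hp), h⟩
  rw [isEven_iff_shows hK₁, isEven_iff_shows hK, hocc]
  -- The occurrence of `z` outside the move makes `w₁ ++ w₂` nonempty, as the dimension count
  -- requires.
  refine and_congr_right fun ⟨p₀, hp₀, _⟩ => ?_
  constructor
  · rintro ⟨c, hc, hs⟩
    have hx := (hs ⟨x, true, s⟩ (mem_secondWord.2 (by simp))).2 (by rintro rfl; simp at hz)
    have hy := (hs ⟨y, true, -s⟩ (mem_secondWord.2 (by simp))).2 (by rintro rfl; simp at hz)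
    obtain ⟨f, f', k₁, k₂, k₃, k₄, -⟩ := transit_of_secondWord hK₁ hc (hx.trans hy.symm)
    exact ⟨c, (isColoring_iff_transit hK).2 ⟨f, (transit_append _ _ _ _ _).2 ⟨f', k₂, k₄⟩⟩,
      fun p hp => hs p (mem_secondWord.2 (.inr hp))⟩
  · rintro ⟨c, hc, hs⟩
    obtain ⟨e, he⟩ := (isColoring_iff_transit hK).1 hc
    obtain ⟨e', h₁, h₂⟩ := (transit_append _ _ _ _ _).1 he
    have hside := side_eq_of_eulerChar_eq hK hK₁ (List.ne_nil_of_mem hp₀) hχ h₁ h₂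
    obtain ⟨v, v', k₁, k₂, hx, hy⟩ := exists_recolor_second hxy o o' s c e e' 0 hside
    have hoff := recolor_recolor_off (x := x) (y := y) v v' c
    generalize recolor x v (recolor y v' c) = c' at *
    refine ⟨c', (isColoring_iff_transit hK₁).2
      ⟨e, transit_secondWord.2 ⟨e, e', e', k₁, ?_, k₂, ?_⟩⟩, fun p hp => ?_⟩
    · exact (transit_congr_off (S := fun z => z = x ∨ z = y) hoff fun p hp =>
        hne p (List.mem_append_left _ hp)).2 h₁
    · exact (transit_congr_off (S := fun z => z = x ∨ z = y) hoff fun p hp =>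
        hne p (List.mem_append_right _ hp)).2 h₂
    · rcases mem_secondWord.1 hp with (rfl | rfl | rfl | rfl) | hp
      · exact ⟨fun h => absurd (.inl h.symm) hz, fun _ => hx⟩
      · exact ⟨fun h => absurd (.inl h.symm) hz, fun _ =>
          (vertexSum_opposite c' ⟨x, true, s⟩).trans hx⟩
      · exact ⟨fun h => absurd (.inr h.symm) hz, fun _ => hy⟩
      · exact ⟨fun h => absurd (.inr h.symm) hz, fun _ =>
          (vertexSum_opposite c' ⟨y, true, -s⟩).trans hy⟩
      · rw [vertexSum_congr_off (S := fun z => z = x ∨ z = y) hoff (hne p hp)]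
        exact hs p hp

theorem l_takes_second (hχ : K.eulerChar = K₁.eulerChar)
    (h : (ReidemeisterMove.second x y).Takes K K₁) :
    (ReidemeisterMove.second x y).Takes K.l K₁.l ∨ K.l = K₁.l := by
  classical
  obtain ⟨hxy, s, o, o', w₁, w₂, hK, hK₁⟩ := h
  have hK₁ : K₁.core = secondWord x y s o o' w₁ w₂ := hK₁
  have hne := secondWord_crossing_ne hK₁
  have hcomm := isEven_second_comm hxy hK₁
  have hf : ∀ w : List (ChordEnd X), (∀ p ∈ w, p ∈ w₁ ++ w₂) →
      (w.filter fun p => decide (K₁.IsEven p.crossing)) =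
        w.filter fun p => decide (K.IsEven p.crossing) := fun w hw =>
    List.filter_congr fun p hp => by rw [isEven_second_iff hxy hK hK₁ hχ (hne p (hw p hp))]
  have hf₁ := hf w₁ fun p hp => List.mem_append_left _ hp
  have hf₂ := hf w₂ fun p hp => List.mem_append_right _ hp
  have hl := K.l_core_eq hK
  have hl₁ := K₁.l_core_eq hK₁
  simp only [secondWord, List.filter_append, hf₁, hf₂] at hl hl₁
  by_cases hx : K₁.IsEven x
  · have hy := hcomm.1 hx
    refine .inl ⟨hxy, s, o, o', _, _, hl, ?_⟩
    rw [hl₁, filter_orderedPair, filter_orderedPair] <;> simpa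
  · have hy := mt hcomm.2 hx
    refine .inr (GaussDiagram.ext ?_)
    rw [hl, hl₁]
    have hP : ∀ (o : ℤˣ) (i : Bool), ((orderedPair o (⟨x, i, s⟩ : ChordEnd X) ⟨y, i, -s⟩).filter
        fun p => decide (K₁.IsEven p.crossing)) = [] := by
      intro o i
      rw [List.filter_eq_nil_iff]
      intro p hp
      rcases mem_orderedPair.1 hp with rfl | rfl <;> simpa
    rw [hP, hP]
    simp

end Second

end GaussDiagram

namespace GaussDiagram

variable {X : Type*} {K K₁ : GaussDiagram X}

/-! ### The third move. -/

section Third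

/-- A word with three distinguished blocks. -/
def blockWord (B₁ w₁ B₂ w₂ B₃ w₃ : List (ChordEnd X)) : List (ChordEnd X) :=
  B₁ ++ w₁ ++ B₂ ++ w₂ ++ B₃ ++ w₃

variable {B₁ B₂ B₃ B₁' B₂' B₃' w₁ w₂ w₃ : List (ChordEnd X)}

theorem blockWord_perm : (blockWord B₁ w₁ B₂ w₂ B₃ w₃).Perm
    (B₁ ++ B₂ ++ B₃ ++ (w₁ ++ w₂ ++ w₃)) := by
  classical
  rw [List.perm_iff_count]
  intro a
  simp only [blockWord, List.count_append]
  omega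

theorem transit_blockWord {c : ChordEnd X × Bool → ZMod 2} {e f : EdgeState} :
    Transit c (blockWord B₁ w₁ B₂ w₂ B₃ w₃) e f ↔ ∃ f₁ e₂ f₂ e₃ f₃, Transit c B₁ e f₁ ∧
      Transit c w₁ f₁ e₂ ∧ Transit c B₂ e₂ f₂ ∧ Transit c w₂ f₂ e₃ ∧ Transit c B₃ e₃ f₃ ∧
      Transit c w₃ f₃ f := by
  simp only [blockWord, transit_append]
  constructor
  · rintro ⟨_, ⟨_, ⟨_, ⟨_, ⟨_, h₁, h₂⟩, h₃⟩, h₄⟩, h₅⟩, h₆⟩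
    exact ⟨_, _, _, _, _, h₁, h₂, h₃, h₄, h₅, h₆⟩
  · rintro ⟨_, _, _, _, _, h₁, h₂, h₃, h₄, h₅, h₆⟩
    exact ⟨_, ⟨_, ⟨_, ⟨_, ⟨_, h₁, h₂⟩, h₃⟩, h₄⟩, h₅⟩, h₆⟩

/-- If colourings of three blocks of chord ends can be transferred to other blocks, without change
at their borders and of the sums, then even crossings stay even when the blocks are replaced. -/
theorem IsEven.of_replace {S : X → Prop} (hK : K.core = blockWord B₁ w₁ B₂ w₂ B₃ w₃)
    (hK₁ : K₁.core = blockWord B₁' w₁ B₂' w₂ B₃' w₃)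
    (hw : ∀ p ∈ w₁ ++ w₂ ++ w₃, ¬ S p.crossing)
    (hB : ∀ p, p ∈ B₁' ++ B₂' ++ B₃' ↔ p ∈ B₁ ++ B₂ ++ B₃)
    (hr : ∀ c e₁ f₁ e₂ f₂ e₃ f₃, Transit c B₁ e₁ f₁ → Transit c B₂ e₂ f₂ → Transit c B₃ e₃ f₃ →
      ∃ c' : ChordEnd X × Bool → ZMod 2, (∀ d : ChordEnd X × Bool, ¬ S d.1.crossing → c' d = c d) ∧
        Transit c' B₁' e₁ f₁ ∧ Transit c' B₂' e₂ f₂ ∧ Transit c' B₃' e₃ f₃ ∧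
        ∀ p ∈ B₁ ++ B₂ ++ B₃, vertexSum c' p = vertexSum c p) {z : X} (hz : K.IsEven z) :
    K₁.IsEven z := by
  have hmem : ∀ p, p ∈ blockWord B₁' w₁ B₂' w₂ B₃' w₃ ↔ p ∈ blockWord B₁ w₁ B₂ w₂ B₃ w₃ := by
    intro p
    rw [blockWord_perm.mem_iff, blockWord_perm.mem_iff, List.mem_append, hB, ← List.mem_append]
  rw [isEven_iff_shows hK] at hz
  rw [isEven_iff_shows hK₁]
  obtain ⟨⟨p₀, hp₀, h₀⟩, c, hc, hs⟩ := hz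
  refine ⟨⟨p₀, (hmem _).2 hp₀, h₀⟩, ?_⟩
  obtain ⟨e, he⟩ := (isColoring_iff_transit hK).1 hc
  obtain ⟨f₁, e₂, f₂, e₃, f₃, h₁, k₁, h₂, k₂, h₃, k₃⟩ := transit_blockWord.1 he
  obtain ⟨c', hoff, h₁', h₂', h₃', hs'⟩ := hr c _ _ _ _ _ _ h₁ h₂ h₃
  refine ⟨c', (isColoring_iff_transit hK₁).2 ⟨e, transit_blockWord.2
    ⟨f₁, e₂, f₂, e₃, f₃, h₁', ?_, h₂', ?_, h₃', ?_⟩⟩, fun p hp => ?_⟩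
  · exact (transit_congr_off hoff fun p hp => hw p (by simp [hp])).2 k₁
  · exact (transit_congr_off hoff fun p hp => hw p (by simp [hp])).2 k₂
  · exact (transit_congr_off hoff fun p hp => hw p (by simp [hp])).2 k₃
  · have hp := (hmem p).1 hp
    have : vertexSum c' p = vertexSum c p := by
      rcases List.mem_append.1 (blockWord_perm.mem_iff.1 hp) with h | h
      · exact hs' p h
      · exact vertexSum_congr_off hoff (hw p h)
    rw [this]
    exact hs p hp

variable {x y z : X}

/-- If the sum of the three crossings is a relation, and two of them are even, so is the third. -/
theorem IsEven.of_triangle {S : X → Prop} {w : List (ChordEnd X)} (hK : K.core = w)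
    (hS : ∀ u, S u ↔ u = x ∨ u = y ∨ u = z)
    (hb : ∃ b, K.IsColoring b ∧ ∀ p ∈ w, (S p.crossing → vertexSum b p = 1) ∧
      (¬ S p.crossing → vertexSum b p = 0))
    (hxy : x ≠ y) (hxz : x ≠ z) (hyz : y ≠ z) (hz : ∃ p ∈ w, p.crossing = z)
    (hx : K.IsEven x) (hy : K.IsEven y) : K.IsEven z := by
  rw [isEven_iff_shows hK] at *
  obtain ⟨b, hb, hb'⟩ := hb
  obtain ⟨-, c, hc, hc'⟩ := hx
  obtain ⟨-, d, hd, hd'⟩ := hy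
  refine ⟨hz, c + d + b, (hc.add hd).add hb, fun p hp => ?_⟩
  have h₁ := hb' p hp
  have h₂ := hc' p hp
  have h₃ := hd' p hp
  rw [hS] at h₁
  rw [vertexSum_add, vertexSum_add]
  by_cases hx : p.crossing = x <;> by_cases hy : p.crossing = y <;>
    by_cases hz : p.crossing = z <;> grind

/-- The ends on the top strand of a third move. -/
def topPair (x y : X) (sx sy η : ℤˣ) : List (ChordEnd X) :=
  orderedPair (η * sy) ⟨x, true, sx⟩ ⟨y, true, sy⟩

/-- The ends on the middle strand of a third move. -/
def midPair (x z : X) (sx sz η : ℤˣ) : List (ChordEnd X) :=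
  orderedPair (η * sz) ⟨x, false, sx⟩ ⟨z, true, sz⟩

/-- The ends on the bottom strand of a third move. -/
def botPair (y z : X) (sx sy sz η : ℤˣ) : List (ChordEnd X) :=
  orderedPair (η * sx * sy * sz) ⟨y, false, sy⟩ ⟨z, false, sz⟩

variable {sx sy sz η : ℤˣ}

theorem mem_pairs {p : ChordEnd X} : (p ∈ topPair x y sx sy η ∨ p ∈ midPair x z sx sz η ∨
    p ∈ botPair y z sx sy sz η) ↔ (p = ⟨x, true, sx⟩ ∨ p = ⟨x, false, sx⟩) ∨
      (p = ⟨y, true, sy⟩ ∨ p = ⟨y, false, sy⟩) ∨ (p = ⟨z, true, sz⟩ ∨ p = ⟨z, false, sz⟩) := by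
  simp only [topPair, midPair, botPair, mem_orderedPair]
  tauto

theorem recolor_three_off (u v w : Bool → Bool → ZMod 2) (c : ChordEnd X × Bool → ZMod 2)
    (d : ChordEnd X × Bool) (hd : ¬ (d.1.crossing = x ∨ d.1.crossing = y ∨ d.1.crossing = z)) :
    recolor x u (recolor y v (recolor z w c)) d = c d := by
  simp only [not_or] at hd
  rw [recolor_of_ne _ _ hd.1, recolor_of_ne _ _ hd.2.1, recolor_of_ne _ _ hd.2.2]

theorem exists_transfer (hxy : x ≠ y) (hxz : x ≠ z) (hyz : y ≠ z)
    (c : ChordEnd X × Bool → ZMod 2) {e₁ f₁ e₂ f₂ e₃ f₃ : EdgeState}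
    (h₁ : Transit c (topPair x y sx sy η) e₁ f₁) (h₂ : Transit c (midPair x z sx sz η) e₂ f₂)
    (h₃ : Transit c (botPair y z sx sy sz η) e₃ f₃) :
    ∃ c' : ChordEnd X × Bool → ZMod 2,
      (∀ d : ChordEnd X × Bool, ¬ (d.1.crossing = x ∨ d.1.crossing = y ∨ d.1.crossing = z) →
        c' d = c d) ∧
      Transit c' (topPair x y sx sy (-η)) e₁ f₁ ∧ Transit c' (midPair x z sx sz (-η)) e₂ f₂ ∧
      Transit c' (botPair y z sx sy sz (-η)) e₃ f₃ ∧
      ∀ p, (p ∈ topPair x y sx sy η ∨ p ∈ midPair x z sx sz η ∨ p ∈ botPair y z sx sy sz η) →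
        vertexSum c' p = vertexSum c p := by
  obtain ⟨u, v, w, k₁, k₂, k₃, hx, hy, hz⟩ :=
    exists_recolor_third hxy hxz hyz sx sy sz η c e₁ f₁ e₂ f₂ e₃ f₃ h₁ h₂ h₃
  refine ⟨_, recolor_three_off u v w c, k₁, k₂, k₃, fun p hp => ?_⟩
  rcases mem_pairs.1 hp with (rfl | rfl) | (rfl | rfl) | (rfl | rfl)
  · exact hx
  · rw [← vertexSum_opposite, ← vertexSum_opposite c]
    exact hx
  · exact hy
  · rw [← vertexSum_opposite, ← vertexSum_opposite c]
    exact hy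
  · exact hz
  · rw [← vertexSum_opposite, ← vertexSum_opposite c]
    exact hz

/-- Blocks which are the three strands of a third move, in one of the cyclic orders. -/
def AreStrands (x y z : X) (sx sy sz : ℤˣ) (B₁ B₂ B₃ : ℤˣ → List (ChordEnd X)) : Prop :=
  B₁ = topPair x y sx sy ∧
    (B₂ = midPair x z sx sz ∧ B₃ = botPair y z sx sy sz ∨
      B₂ = botPair y z sx sy sz ∧ B₃ = midPair x z sx sz)

section

variable {B₁ B₂ B₃ : ℤˣ → List (ChordEnd X)}

theorem AreStrands.mem (hB : AreStrands x y z sx sy sz B₁ B₂ B₃) {p : ChordEnd X} :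
    p ∈ B₁ η ++ B₂ η ++ B₃ η ↔ (p = ⟨x, true, sx⟩ ∨ p = ⟨x, false, sx⟩) ∨
      (p = ⟨y, true, sy⟩ ∨ p = ⟨y, false, sy⟩) ∨ (p = ⟨z, true, sz⟩ ∨ p = ⟨z, false, sz⟩) := by
  rw [← mem_pairs (η := η), List.mem_append, List.mem_append]
  obtain ⟨rfl, ⟨rfl, rfl⟩ | ⟨rfl, rfl⟩⟩ := hB <;> tauto

theorem AreStrands.crossing_ne (hB : AreStrands x y z sx sy sz B₁ B₂ B₃)
    (hK : K.core = blockWord (B₁ η) w₁ (B₂ η) w₂ (B₃ η) w₃) :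
    ∀ p ∈ w₁ ++ w₂ ++ w₃, ¬ (p.crossing = x ∨ p.crossing = y ∨ p.crossing = z) := by
  have hx := crossing_ne_of_mem_of_perm (x := x) (o := true) (s := sx) (s' := sx) hK blockWord_perm
    (hB.mem.2 (by simp)) (hB.mem.2 (by simp))
  have hy := crossing_ne_of_mem_of_perm (x := y) (o := true) (s := sy) (s' := sy) hK blockWord_perm
    (hB.mem.2 (by simp)) (hB.mem.2 (by simp))
  have hz := crossing_ne_of_mem_of_perm (x := z) (o := true) (s := sz) (s' := sz) hK blockWord_perm
    (hB.mem.2 (by simp)) (hB.mem.2 (by simp))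
  intro p hp
  simp [hx p hp, hy p hp, hz p hp]

theorem AreStrands.isEven (hB : AreStrands x y z sx sy sz B₁ B₂ B₃) (hxy : x ≠ y) (hxz : x ≠ z)
    (hyz : y ≠ z) (hK : K.core = blockWord (B₁ η) w₁ (B₂ η) w₂ (B₃ η) w₃)
    (hK₁ : K₁.core = blockWord (B₁ (-η)) w₁ (B₂ (-η)) w₂ (B₃ (-η)) w₃) {u : X}
    (hu : K.IsEven u) : K₁.IsEven u := by
  refine IsEven.of_replace (S := fun u => u = x ∨ u = y ∨ u = z) hK hK₁ (hB.crossing_ne hK)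
    (fun p => by rw [hB.mem, hB.mem]) ?_ hu
  intro c e₁ f₁ e₂ f₂ e₃ f₃ h₁ h₂ h₃
  have hm : ∀ p ∈ B₁ η ++ B₂ η ++ B₃ η, p ∈ topPair x y sx sy η ∨ p ∈ midPair x z sx sz η ∨
      p ∈ botPair y z sx sy sz η := fun p hp => mem_pairs.2 (hB.mem.1 hp)
  obtain ⟨rfl, ⟨rfl, rfl⟩ | ⟨rfl, rfl⟩⟩ := hB
  · obtain ⟨c', h, k₁, k₂, k₃, hs⟩ := exists_transfer hxy hxz hyz c h₁ h₂ h₃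
    exact ⟨c', h, k₁, k₂, k₃, fun p hp => hs p (hm p hp)⟩
  · obtain ⟨c', h, k₁, k₂, k₃, hs⟩ := exists_transfer hxy hxz hyz c h₁ h₃ h₂
    exact ⟨c', h, k₁, k₃, k₂, fun p hp => hs p (hm p hp)⟩

/-- The inverse of a third move is again a third move, with `-η` in place of `η`. -/
theorem AreStrands.isEven_iff (hB : AreStrands x y z sx sy sz B₁ B₂ B₃) (hxy : x ≠ y) (hxz : x ≠ z)
    (hyz : y ≠ z) (hK : K.core = blockWord (B₁ η) w₁ (B₂ η) w₂ (B₃ η) w₃)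
    (hK₁ : K₁.core = blockWord (B₁ (-η)) w₁ (B₂ (-η)) w₂ (B₃ (-η)) w₃) {u : X} :
    K₁.IsEven u ↔ K.IsEven u :=
  ⟨hB.isEven hxy hxz hyz hK₁ (by rwa [neg_neg]), hB.isEven hxy hxz hyz hK hK₁⟩

theorem AreStrands.exists_triangle (hB : AreStrands x y z sx sy sz B₁ B₂ B₃) (hxy : x ≠ y)
    (hxz : x ≠ z) (hyz : y ≠ z) (hK : K.core = blockWord (B₁ η) w₁ (B₂ η) w₂ (B₃ η) w₃) :
    ∃ b, K.IsColoring b ∧ ∀ p ∈ blockWord (B₁ η) w₁ (B₂ η) w₂ (B₃ η) w₃,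
      ((p.crossing = x ∨ p.crossing = y ∨ p.crossing = z) → vertexSum b p = 1) ∧
      (¬ (p.crossing = x ∨ p.crossing = y ∨ p.crossing = z) → vertexSum b p = 0) := by
  have hne := hB.crossing_ne hK
  obtain ⟨u, v, w, k₁, k₂, k₃, hx, hy, hz⟩ := exists_recolor_triangle hxy hxz hyz sx sy sz η 0
  have hoff := recolor_three_off (x := x) (y := y) (z := z) u v w 0
  generalize recolor x u (recolor y v (recolor z w 0)) = b at *
  have hw : ∀ w, (∀ p ∈ w, p ∈ w₁ ++ w₂ ++ w₃) → Transit b w 0 0 := fun w hw =>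
    (transit_congr_off (S := fun u => u = x ∨ u = y ∨ u = z) hoff fun p hp =>
      hne p (hw p hp)).2 (transit_zero w)
  have l₁ := hw w₁ fun p hp => by simp [hp]
  have l₂ := hw w₂ fun p hp => by simp [hp]
  have l₃ := hw w₃ fun p hp => by simp [hp]
  refine ⟨b, (isColoring_iff_transit hK).2 ⟨0, transit_blockWord.2 ⟨0, 0, 0, 0, 0, ?_⟩⟩, ?_⟩
  · obtain ⟨rfl, ⟨rfl, rfl⟩ | ⟨rfl, rfl⟩⟩ := hB
    · exact ⟨k₁, l₁, k₂, l₂, k₃, l₃⟩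
    · exact ⟨k₁, l₁, k₃, l₂, k₂, l₃⟩
  · intro p hp
    refine ⟨fun h => ?_, fun h => ?_⟩
    · rcases List.mem_append.1 (blockWord_perm.mem_iff.1 hp) with hp | hp
      · rcases hB.mem.1 hp with (rfl | rfl) | (rfl | rfl) | (rfl | rfl)
        · exact hx
        · exact (vertexSum_opposite b ⟨x, true, sx⟩).trans hx
        · exact hy
        · exact (vertexSum_opposite b ⟨y, true, sy⟩).trans hy
        · exact hz
        · exact (vertexSum_opposite b ⟨z, true, sz⟩).trans hz
      · exact absurd h (hne p hp)
    · exact vertexSum_congr_off (S := fun u => u = x ∨ u = y ∨ u = z) hoff h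

/-- By the triangle relation, two even crossings among the three make the third even. So unless all
three are even at most one is, and each strand, meeting two of them, keeps at most one end. -/
theorem AreStrands.filter_or (hB : AreStrands x y z sx sy sz B₁ B₂ B₃) (hxy : x ≠ y)
    (hxz : x ≠ z) (hyz : y ≠ z) (hK : K.core = blockWord (B₁ η) w₁ (B₂ η) w₂ (B₃ η) w₃)
    (P : ChordEnd X → Bool) (hP : ∀ p, P p = true ↔ K.IsEven p.crossing) :
    (∀ η', (B₁ η').filter P = B₁ η' ∧ (B₂ η').filter P = B₂ η' ∧ (B₃ η').filter P = B₃ η') ∨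
      (∀ η' η'', (B₁ η').filter P = (B₁ η'').filter P ∧ (B₂ η').filter P = (B₂ η'').filter P ∧
        (B₃ η').filter P = (B₃ η'').filter P) := by
  have hb := hB.exists_triangle hxy hxz hyz hK
  have hmem : ∀ p, p = ⟨x, true, sx⟩ ∨ p = ⟨y, true, sy⟩ ∨ p = ⟨z, true, sz⟩ →
      p ∈ blockWord (B₁ η) w₁ (B₂ η) w₂ (B₃ η) w₃ := fun p hp =>
    blockWord_perm.mem_iff.2 (List.mem_append_left _ (hB.mem.2 (by tauto)))
  have h₁ := IsEven.of_triangle (x := x) (y := y) (z := z) hK (fun _ => Iff.rfl) hb hxy hxz hyz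
    ⟨_, hmem _ (.inr (.inr rfl)), rfl⟩
  have h₂ := IsEven.of_triangle (x := x) (y := z) (z := y)
    (S := fun u => u = x ∨ u = y ∨ u = z) hK (fun _ => by tauto) hb hxz hxy hyz.symm
    ⟨_, hmem _ (.inr (.inl rfl)), rfl⟩
  have h₃ := IsEven.of_triangle (x := y) (y := z) (z := x)
    (S := fun u => u = x ∨ u = y ∨ u = z) hK (fun _ => by tauto) hb hyz hxy.symm
    hxz.symm ⟨_, hmem _ (.inl rfl), rfl⟩
  by_cases hall : K.IsEven x ∧ K.IsEven y ∧ K.IsEven z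
  · obtain ⟨hx, hy, hz⟩ := hall
    left
    intro η'
    have ht : (topPair x y sx sy η').filter P = topPair x y sx sy η' :=
      filter_orderedPair P _ ((hP _).2 hx) ((hP _).2 hy)
    have hm : (midPair x z sx sz η').filter P = midPair x z sx sz η' :=
      filter_orderedPair P _ ((hP _).2 hx) ((hP _).2 hz)
    have hc : (botPair y z sx sy sz η').filter P = botPair y z sx sy sz η' :=
      filter_orderedPair P _ ((hP _).2 hy) ((hP _).2 hz)
    obtain ⟨rfl, ⟨rfl, rfl⟩ | ⟨rfl, rfl⟩⟩ := hB
    · exact ⟨ht, hm, hc⟩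
    · exact ⟨ht, hc, hm⟩
  · right
    intro η' η''
    have ht : (topPair x y sx sy η').filter P = (topPair x y sx sy η'').filter P :=
      filter_orderedPair_eq P _ _ (by simp only [hP]; tauto)
    have hm : (midPair x z sx sz η').filter P = (midPair x z sx sz η'').filter P :=
      filter_orderedPair_eq P _ _ (by simp only [hP]; tauto)
    have hc : (botPair y z sx sy sz η').filter P = (botPair y z sx sy sz η'').filter P :=
      filter_orderedPair_eq P _ _ (by simp only [hP]; tauto)
    obtain ⟨rfl, ⟨rfl, rfl⟩ | ⟨rfl, rfl⟩⟩ := hB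
    · exact ⟨ht, hm, hc⟩
    · exact ⟨ht, hc, hm⟩

theorem AreStrands.l_core (hB : AreStrands x y z sx sy sz B₁ B₂ B₃) (hxy : x ≠ y)
    (hxz : x ≠ z) (hyz : y ≠ z) (hK : K.core = blockWord (B₁ η) w₁ (B₂ η) w₂ (B₃ η) w₃)
    (hK₁ : K₁.core = blockWord (B₁ (-η)) w₁ (B₂ (-η)) w₂ (B₃ (-η)) w₃) :
    (∃ w₁ w₂ w₃, K.l.core = blockWord (B₁ η) w₁ (B₂ η) w₂ (B₃ η) w₃ ∧
      K₁.l.core = blockWord (B₁ (-η)) w₁ (B₂ (-η)) w₂ (B₃ (-η)) w₃) ∨ K.l = K₁.l := by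
  classical
  have hl := K.l_core_eq hK
  have hl₁ := K₁.l_core_eq hK₁
  simp only [hB.isEven_iff hxy hxz hyz hK hK₁] at hl₁
  simp only [blockWord, List.filter_append] at hl hl₁
  rcases hB.filter_or hxy hxz hyz hK (fun p => decide (K.IsEven p.crossing)) (by simp) with h | h
  · rw [(h η).1, (h η).2.1, (h η).2.2] at hl
    rw [(h (-η)).1, (h (-η)).2.1, (h (-η)).2.2] at hl₁
    exact .inl ⟨_, _, _, hl, hl₁⟩
  · refine .inr (GaussDiagram.ext ?_)
    rw [hl, hl₁, (h η (-η)).1, (h η (-η)).2.1, (h η (-η)).2.2]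

end

theorem l_takes_third (h : (ReidemeisterMove.third x y z).Takes K K₁) :
    (ReidemeisterMove.third x y z).Takes K.l K₁.l ∨ K.l = K₁.l := by
  obtain ⟨hxy, hxz, hyz, sx, sy, sz, η, w₁, w₂, w₃, ⟨hK, hK₁⟩ | ⟨hK, hK₁⟩⟩ := h
  · refine (AreStrands.l_core (sx := sx) (sy := sy) (sz := sz) ⟨rfl, .inl ⟨rfl, rfl⟩⟩ hxy hxz hyz
      hK hK₁).imp_left ?_
    rintro ⟨w₁, w₂, w₃, h⟩
    exact ⟨hxy, hxz, hyz, sx, sy, sz, η, w₁, w₂, w₃, .inl h⟩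
  · refine (AreStrands.l_core (sx := sx) (sy := sy) (sz := sz) ⟨rfl, .inr ⟨rfl, rfl⟩⟩ hxy hxz hyz
      hK hK₁).imp_left ?_
    rintro ⟨w₁, w₂, w₃, h⟩
    exact ⟨hxy, hxz, hyz, sx, sy, sz, η, w₁, w₂, w₃, .inr h⟩

end Third

end GaussDiagram

theorem mainTheorem7 {X : Type*} (g : ℕ) :
    (∀ (m : ReidemeisterMove X) (K K₁ : GaussDiagram X), K.HasGenus g → K₁.HasGenus g →
      m.Takes K K₁ → m.Takes K.l K₁.l ∨ K.l = K₁.l) ∧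
    (∀ K : GaussDiagram X, K.HasGenus g → (K.l.VirtuallyEquivalent K ↔ K.IsClassical)) := by
  refine ⟨fun m K K₁ hK hK₁ h => ?_, fun K hK => K.l_virtuallyEquivalent_iff hK⟩
  cases m with
  | first x => exact .inl (GaussDiagram.l_takes_first h)
  | second x y => exact GaussDiagram.l_takes_second (hK.trans hK₁.symm) h
  | third x y z => exact GaussDiagram.l_takes_third h
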